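/- Let $(M,g)$ be a closed (compact, without boundary), oriented, smooth $n$-dimensional Riemannian manifold with Levi-Civita connection $\nabla$ and canonical volume form $\mu$. Let $\mathfrak X(M)$ be the Lie algebra of smooth vector fields with the usual Lie bracket, and put $\operatorname{ad}(X)Y=[X,Y]$. For $Y\in\mathfrak X(M)$ let $\flat Y=g(Y,\cdot)$, let $\operatorname{div}Y$ be the function with $L_Y\mu=(\operatorname{div}Y)\,\mu$, and for a $1$-form $\varphi$ put $(\nabla\varphi)^{\mathrm{sym}}(X,Z)=(\nabla_X\varphi)(Z)+(\nabla_Z\varphi)(X)$. A vector field is called Killing if it generates a flow of isometries of $(M,g)$. (1) Let $\mathfrak g\subseteq\mathfrak X(M)$ be a Lie subalgebra (for example a closed one) such that for every $X\in\mathfrak g$ the adjoint $\operatorname{ad}(X)^{\top}:\mathfrak g\to\mathfrak g$ of $\operatorname{ad}(X)$ with respect to the $L^2$ scalar product $\langle Z,W\rangle=\int_M g(Z,W)\,\mu$ exists, i.e. a linear map with $\langle\operatorname{ad}(X)^{\top}Z,W\rangle=\langle Z,[X,W]\rangle$ for all $Z,W\in\mathfrak g$. Then for all $X,Y\in\mathfrak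 g$ $$2\int_M g(\operatorname{ad}(X)^{\top}X,Y)\,\mu=\int_M\big((\nabla\flat Y)^{\mathrm{sym}}+(\operatorname{div}Y)\,g\big)(X,X)\,\mu .$$ (2) For every $Y\in\mathfrak X(M)$, the trace with respect to $g$ satisfies $$\operatorname{tr}\big((\nabla\flat Y)^{\mathrm{sym}}+(\operatorname{div}Y)\,g\big)=(n+2)\operatorname{div}Y .$$ (3) For every $Y\in\mathfrak X(M)$, the tensor field $(\nabla\flat Y)^{\mathrm{sym}}+(\operatorname{div}Y)\,g$ vanishes if and only if $(\nabla\flat Y)^{\mathrm{sym}}=0$, and it vanishes if and only if $Y$ is a Killing vector field. -/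

import Mathlib

open Bundle Manifold VectorField MeasureTheory
open scoped ContDiff Topology

noncomputable section

namespace RiemGeom

section LeviCivita

variable {E : Type*} [NormedAddCommGroup E] [NormedSpace ℝ E]
  {H : Type*} [TopologicalSpace H] {I : ModelWithCorners ℝ E H}
  {M : Type*} [TopologicalSpace M] [ChartedSpace H M]
  [RiemannianBundle (fun x : M => TangentSpace I x)]

variable (I) in
/-- The Riemannian metric `g` as a field of bilinear forms. -/
def metricTensor (x : M) : TangentSpace I x →L[ℝ] TangentSpace I x →L[ℝ] ℝ :=
  (RiemannianBundle.g (E := fun x : M => TangentSpace I x)).inner x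

theorem metricTensor_apply (x : M) (v w : TangentSpace I x) :
    metricTensor I x v w = inner ℝ v w := rfl

variable (I) in
/-- The right hand side of the Koszul formula for `2 g(∇_X Y, Z)`:
`X g(Y,Z) + Y g(Z,X) - Z g(X,Y) + g([X,Y],Z) - g([X,Z],Y) - g([Y,Z],X)`. -/
def koszul (Y X Z : ∀ x : M, TangentSpace I x) (x : M) : ℝ :=
  mvfderiv I (fun p => inner ℝ (Y p) (Z p)) x (X x)
  + mvfderiv I (fun p => inner ℝ (Z p) (X p)) x (Y x)
  - mvfderiv I (fun p => inner ℝ (X p) (Y p)) x (Z x)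
  + inner ℝ (mlieBracket I X Y x) (Z x)
  - inner ℝ (mlieBracket I X Z x) (Y x)
  - inner ℝ (mlieBracket I Y Z x) (X x)

variable [IsManifold I ∞ M] [IsContMDiffRiemannianBundle I ∞ E (fun x : M => TangentSpace I x)]

theorem mdiffAt_inner {x : M} {Y Z : ∀ x : M, TangentSpace I x}
    (hY : MDiffAt (T% Y) x) (hZ : MDiffAt (T% Z) x) :
    MDiffAt (fun p => inner ℝ (Y p) (Z p)) x :=
  MDifferentiableAt.inner_bundle (IB := I) (F := E) (E := fun x : M => TangentSpace I x) hY hZ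

variable [FiniteDimensional ℝ E]

theorem koszul_tensorial_left {x : M} {Y Z : ∀ x : M, TangentSpace I x}
    (hY : MDiffAt (T% Y) x) (hZ : MDiffAt (T% Z) x) :
    TensorialAt I E (fun X => koszul I Y X Z x) x where
  smul {f X} hf hX := by
    have : CompleteSpace E := FiniteDimensional.complete ℝ E
    have : IsManifold I (minSmoothness ℝ 2) M := by simp; infer_instance
    have h1 := mvfderiv_fun_mul hf (mdiffAt_inner hZ hX)
    have h2 := mvfderiv_fun_mul hf (mdiffAt_inner hX hY)
    simp [koszul, mlieBracket_smul_left hf hX, inner_add_left, inner_smul_left, inner_smul_right,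
      h1, h2]
    rw [real_inner_comm (X x) (Z x)]
    ring
  add {X X'} hX hX' := by
    have : CompleteSpace E := FiniteDimensional.complete ℝ E
    have : IsManifold I (minSmoothness ℝ 2) M := by simp; infer_instance
    have h1 := mvfderiv_fun_add (mdiffAt_inner hZ hX) (mdiffAt_inner hZ hX')
    have h2 := mvfderiv_fun_add (mdiffAt_inner hX hY) (mdiffAt_inner hX' hY)
    simp [koszul, mlieBracket_add_left hX hX', inner_add_left, inner_add_right, h1, h2]
    ring

theorem koszul_tensorial_right {x : M} {Y X : ∀ x : M, TangentSpace I x}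
    (hY : MDiffAt (T% Y) x) (hX : MDiffAt (T% X) x) :
    TensorialAt I E (fun Z => koszul I Y X Z x) x where
  smul {f Z} hf hZ := by
    have : CompleteSpace E := FiniteDimensional.complete ℝ E
    have : IsManifold I (minSmoothness ℝ 2) M := by simp; infer_instance
    have h1 := mvfderiv_fun_mul hf (mdiffAt_inner hZ hX)
    have h2 := mvfderiv_fun_mul hf (mdiffAt_inner hY hZ)
    simp [koszul, mlieBracket_smul_right hf hZ, inner_add_left, inner_smul_left, inner_smul_right,
      h1, h2]
    rw [real_inner_comm (Z x) (Y x)]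
    ring
  add {Z Z'} hZ hZ' := by
    have : CompleteSpace E := FiniteDimensional.complete ℝ E
    have : IsManifold I (minSmoothness ℝ 2) M := by simp; infer_instance
    have h1 := mvfderiv_fun_add (mdiffAt_inner hZ hX) (mdiffAt_inner hZ' hX)
    have h2 := mvfderiv_fun_add (mdiffAt_inner hY hZ) (mdiffAt_inner hY hZ')
    simp [koszul, mlieBracket_add_right hZ hZ', inner_add_left, inner_add_right, h1, h2]
    ring

variable (I) in
open Classical in
/-- The bilinear form `(X, Z) ↦ 2 g(∇_X Y, Z)` at `x`, given by the Koszul formula (and `0` if `Y` is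
not differentiable at `x`). -/
def koszulTensor (Y : ∀ x : M, TangentSpace I x) (x : M) :
    TangentSpace I x →L[ℝ] TangentSpace I x →L[ℝ] ℝ :=
  if hY : MDiffAt (T% Y) x then
    TensorialAt.mkHom₂ (fun X Z => koszul I Y X Z x) x
      (fun _ hZ => koszul_tensorial_left hY hZ) (fun _ hX => koszul_tensorial_right hY hX)
  else 0

instance instFiniteDimensionalTangent (x : M) : FiniteDimensional ℝ (TangentSpace I x) :=
  inferInstanceAs (FiniteDimensional ℝ E)

instance instCompleteTangent (x : M) : CompleteSpace (TangentSpace I x) :=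
  FiniteDimensional.complete ℝ _

theorem koszulTensor_apply {x : M} {Y X Z : ∀ x : M, TangentSpace I x}
    (hY : MDiffAt (T% Y) x) (hX : MDiffAt (T% X) x) (hZ : MDiffAt (T% Z) x) :
    koszulTensor I Y x (X x) (Z x) = koszul I Y X Z x := by
  rw [koszulTensor, dif_pos hY, TensorialAt.mkHom₂_apply _ _ hX hZ]

variable (I) in
/-- The Levi-Civita covariant derivative as a function: `nabla I Y x v` is `∇_v Y` at `x`. -/
def nabla (Y : ∀ x : M, TangentSpace I x) (x : M) : TangentSpace I x →L[ℝ] TangentSpace I x :=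
  (1 / 2 : ℝ) • InnerProductSpace.continuousLinearMapOfBilin (𝕜 := ℝ) (koszulTensor I Y x)

theorem inner_nabla {x : M} {Y X Z : ∀ x : M, TangentSpace I x}
    (hY : MDiffAt (T% Y) x) (hX : MDiffAt (T% X) x) (hZ : MDiffAt (T% Z) x) :
    inner ℝ (nabla I Y x (X x)) (Z x) = (1 / 2) * koszul I Y X Z x := by
  rw [← koszulTensor_apply hY hX hZ]
  simp [nabla, inner_smul_left]

theorem nabla_eq {x : M} {Y : ∀ x : M, TangentSpace I x} (hY : MDiffAt (T% Y) x)
    {A : TangentSpace I x →L[ℝ] TangentSpace I x}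
    (h : ∀ X Z : ∀ x : M, TangentSpace I x, MDiffAt (T% X) x → MDiffAt (T% Z) x →
      inner ℝ (A (X x)) (Z x) = (1 / 2) * koszul I Y X Z x) : nabla I Y x = A := by
  ext v
  refine ext_inner_right ℝ fun w => ?_
  have hv : MDiffAt (T% (FiberBundle.extend E v)) x := FiberBundle.mdifferentiableAt_extend ..
  have hw : MDiffAt (T% (FiberBundle.extend E w)) x := FiberBundle.mdifferentiableAt_extend ..
  have h1 := inner_nabla hY hv hw
  have h2 := h _ _ hv hw
  simp only [FiberBundle.extend_apply_self] at h1 h2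
  rw [h1, h2]

variable (I M) in
/-- The Levi-Civita connection of the Riemannian manifold `M`; it is torsion-free and metric by the
two theorems below. -/
def leviCivita : CovariantDerivative I E (TangentSpace I : M → Type _) where
  toFun := nabla I
  isCovariantDerivativeOnUniv :=
    { add := by
        intro Y Y' x hY hY' _
        have : CompleteSpace E := FiniteDimensional.complete ℝ E
        have : IsManifold I (minSmoothness ℝ 2) M := by simp; infer_instance
        refine nabla_eq (mdifferentiableAt_add_section hY hY') fun X Z hX hZ => ?_
        have h1 := mvfderiv_fun_add (mdiffAt_inner hY hZ) (mdiffAt_inner hY' hZ)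
        have h2 := mvfderiv_fun_add (mdiffAt_inner hX hY) (mdiffAt_inner hX hY')
        simp [inner_add_left, inner_add_right, inner_nabla hY hX hZ, inner_nabla hY' hX hZ,
          koszul, mlieBracket_add_left hY hY', mlieBracket_add_right hY hY', h1, h2]
        ring
      leibniz := by
        intro Y f x hY hf _
        have : CompleteSpace E := FiniteDimensional.complete ℝ E
        have : IsManifold I (minSmoothness ℝ 2) M := by simp; infer_instance
        refine nabla_eq (hf.smul_section hY) fun X Z hX hZ => ?_
        have h1 := mvfderiv_fun_mul hf (mdiffAt_inner hY hZ)
        have h2 := mvfderiv_fun_mul hf (mdiffAt_inner hX hY)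
        simp [inner_add_left, inner_smul_left, inner_smul_right, inner_nabla hY hX hZ, koszul,
          mlieBracket_smul_left hf hY, mlieBracket_smul_right hf hY, h1, h2]
        rw [real_inner_comm (X x) (Y x)]
        ring }

theorem leviCivita_torsion [CompleteSpace E] : (leviCivita I M).torsion = 0 := by
  rw [CovariantDerivative.torsion_eq_zero_iff]
  intro X Y x hX hY
  refine ext_inner_right ℝ fun w => ?_
  have hw : MDiffAt (T% (FiberBundle.extend E w)) x := FiberBundle.mdifferentiableAt_extend ..
  have h1 := inner_nabla hY hX hw
  have h2 := inner_nabla hX hY hw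
  simp only [FiberBundle.extend_apply_self] at h1 h2
  rw [inner_sub_left]
  change inner ℝ (nabla I Y x (X x)) w - inner ℝ (nabla I X x (Y x)) w = _
  rw [h1, h2]
  simp only [koszul, real_inner_comm, mlieBracket_swap_apply (V := Y) (W := X), inner_neg_left,
    FiberBundle.extend_apply_self]
  ring

theorem leviCivita_inner {x : M} {X Y Z : ∀ x : M, TangentSpace I x}
    (hX : MDiffAt (T% X) x) (hY : MDiffAt (T% Y) x) (hZ : MDiffAt (T% Z) x) :
    mvfderiv I (fun p => inner ℝ (Y p) (Z p)) x (X x) =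
      inner ℝ (leviCivita I M Y x (X x)) (Z x) + inner ℝ (Y x) (leviCivita I M Z x (X x)) := by
  have h1 := inner_nabla hY hX hZ
  have h2 := inner_nabla hZ hX hY
  change _ = inner ℝ (nabla I Y x (X x)) (Z x) + inner ℝ (Y x) (nabla I Z x (X x))
  rw [real_inner_comm _ (Y x), h1, h2]
  simp only [koszul, real_inner_comm, mlieBracket_swap_apply (V := Z) (W := Y), inner_neg_left]
  ring

variable (I) in
/-- The one-form `φ` is differentiable at `x`, as a section of the cotangent bundle. -/
def OneFormDiffAt (φ : ∀ x : M, TangentSpace I x →L[ℝ] ℝ) (x : M) : Prop :=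
  MDifferentiableAt I (I.prod 𝓘(ℝ, E →L[ℝ] ℝ))
    (fun p => TotalSpace.mk' (E →L[ℝ] ℝ)
      (E := fun p : M => TangentSpace I p →L[ℝ] Bundle.Trivial M ℝ p) p (φ p)) x

theorem nablaForm_tensorial {φ : ∀ x : M, TangentSpace I x →L[ℝ] ℝ} {x : M}
    (hφ : OneFormDiffAt I φ x) :
    TensorialAt I E (fun Z : ∀ x : M, TangentSpace I x =>
      mvfderiv I (fun p => φ p (Z p)) x - (φ x) ∘L (leviCivita I M Z x)) x := by
  have key : ∀ {Z : ∀ x : M, TangentSpace I x}, MDiffAt (T% Z) x →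
      MDiffAt (fun p => φ p (Z p)) x := by
    intro Z hZ
    have := MDifferentiableAt.clm_bundle_apply (F₁ := E) (F₂ := ℝ) (E₂ := Bundle.Trivial M ℝ)
      (b := fun p : M => p) hφ hZ
    rw [mdifferentiableAt_totalSpace] at this
    exact this.2
  constructor
  · intro f Z hf hZ
    have h1 := mvfderiv_fun_mul hf (key hZ)
    have h2 := (leviCivita I M).isCovariantDerivativeOnUniv.leibniz hZ hf
    ext v
    simp [h1, h2]
    ring
  · intro Z Z' hZ hZ'
    have h1 := mvfderiv_fun_add (key hZ) (key hZ')
    have h2 := (leviCivita I M).isCovariantDerivativeOnUniv.add hZ hZ'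
    ext v
    simp [h1, h2]
    ring

variable (I) in
open Classical in
/-- The covariant derivative of a one-form, as a bilinear form at `x`:
`nablaForm I φ x X Z = (∇_X φ)(Z) = X(φ(Z)) - φ(∇_X Z)` (and `0` if `φ` is not differentiable at
`x`). -/
def nablaForm (φ : ∀ x : M, TangentSpace I x →L[ℝ] ℝ) (x : M) :
    TangentSpace I x →L[ℝ] TangentSpace I x →L[ℝ] ℝ :=
  if hφ : OneFormDiffAt I φ x then
    (TensorialAt.mkHom _ x (nablaForm_tensorial hφ)).flip
  else 0

variable (I) in
/-- The one-form `♭Y = g(Y, ·)`. -/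
def flat (Y : ∀ x : M, TangentSpace I x) (x : M) : TangentSpace I x →L[ℝ] ℝ :=
  metricTensor I x (Y x)

variable (I) in
/-- `(∇φ)^sym(X, Z) = (∇_X φ)(Z) + (∇_Z φ)(X)` (without a factor `1/2`). -/
def nablaFormSym (φ : ∀ x : M, TangentSpace I x →L[ℝ] ℝ) (x : M) :
    TangentSpace I x →L[ℝ] TangentSpace I x →L[ℝ] ℝ :=
  nablaForm I φ x + (nablaForm I φ x).flip

variable (I) in
/-- An isometry of the Riemannian manifold: a diffeomorphism that preserves the metric. -/
def IsRiemannianIsometry (f : M → M) : Prop :=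
  (∃ e : Diffeomorph I I M M ∞, ⇑e = f) ∧
    ∀ (x : M) (v w : TangentSpace I x),
      metricTensor I (f x) (mfderiv I I f x v) (mfderiv I I f x w) = metricTensor I x v w

variable (I) in
/-- `Y` is a Killing vector field: it generates a flow of isometries. -/
def IsKilling (Y : ∀ x : M, TangentSpace I x) : Prop :=
  ∃ Φ : ℝ → M → M, (∀ x, Φ 0 x = x) ∧ (∀ x, IsMIntegralCurve (I := I) (fun t => Φ t x) Y) ∧
    ∀ t, IsRiemannianIsometry I (Φ t)

end LeviCivita

section VectorFields

variable {n : ℕ} {M : Type*} [TopologicalSpace M] [ChartedSpace (EuclideanSpace ℝ (Fin n)) M]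
  [IsManifold (𝓡 n) ∞ M]

variable (n M) in
/-- `𝔛(M)`: the smooth vector fields on the `n`-dimensional manifold `M`. -/
abbrev VField : Type _ :=
  ContMDiffSection (𝓡 n) (EuclideanSpace ℝ (Fin n)) ∞ (fun x : M => TangentSpace (𝓡 n) x)

/-- The usual Lie bracket of smooth vector fields. -/
instance instBracketVField : Bracket (VField n M) (VField n M) where
  bracket X Y := ⟨mlieBracket (𝓡 n) X Y, by
    have : IsManifold (𝓡 n) (((⊤ : ℕ∞) : WithTop ℕ∞) + 1) M := by
      simpa using (inferInstance : IsManifold (𝓡 n) ∞ M)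
    have : IsManifold (𝓡 n) (minSmoothness ℝ 2) M := by simp; infer_instance
    have : IsManifold (𝓡 n) (minSmoothness ℝ 3) M := by simp; infer_instance
    exact ContDiff.mlieBracket_vectorField (I := 𝓡 n) (m := ⊤) (n := ⊤)
      X.contMDiff Y.contMDiff (by simp)⟩

theorem bracket_coe (X Y : VField n M) :
    (⇑⁅X, Y⁆ : ∀ x : M, TangentSpace (𝓡 n) x) = mlieBracket (𝓡 n) X Y := rfl

instance instLieRingVField : LieRing (VField n M) where
  add_lie X Y Z := by
    have : IsManifold (𝓡 n) (minSmoothness ℝ 2) M := by simp; infer_instance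
    ext1 x
    exact mlieBracket_add_left X.mdifferentiableAt Y.mdifferentiableAt
  lie_add X Y Z := by
    have : IsManifold (𝓡 n) (minSmoothness ℝ 2) M := by simp; infer_instance
    ext1 x
    exact mlieBracket_add_right Y.mdifferentiableAt Z.mdifferentiableAt
  lie_self X := by
    ext1 x
    simp [bracket_coe]
  leibniz_lie X Y Z := by
    ext1 x
    have : IsManifold (𝓡 n) (minSmoothness ℝ 3) M := by simp; infer_instance
    have h2 : (minSmoothness ℝ 2 : WithTop ℕ∞) ≤ ∞ := by
      simpa using (ENat.LEInfty.out : (2 : WithTop ℕ∞) ≤ ∞)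
    exact leibniz_identity_mlieBracket_apply (X.contMDiff.of_le h2 x) (Y.contMDiff.of_le h2 x)
      (Z.contMDiff.of_le h2 x)

instance instLieAlgebraVField : LieAlgebra ℝ (VField n M) where
  lie_smul c X Y := by
    have : IsManifold (𝓡 n) (minSmoothness ℝ 2) M := by simp; infer_instance
    ext1 x
    exact mlieBracket_const_smul_right Y.mdifferentiableAt

end VectorFields

section Integration

variable {n : ℕ} {M : Type*} [TopologicalSpace M] [ChartedSpace (EuclideanSpace ℝ (Fin n)) M]

variable (n M) in
/-- An orientation of the manifold `M`: an orientation of each tangent space, locally constant in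
local trivializations of the tangent bundle. -/
structure ManifoldOrientation [IsManifold (𝓡 n) 1 M] where
  /-- The orientation of the tangent space at `x`. -/
  orient (x : M) : Orientation ℝ (TangentSpace (𝓡 n) x) (Fin n)
  locallyConstant (c : M) : ∃ o₀ : Orientation ℝ (EuclideanSpace ℝ (Fin n)) (Fin n),
    ∀ᶠ x in 𝓝 c, ∀ hx : x ∈ (trivializationAt (EuclideanSpace ℝ (Fin n))
        (TangentSpace (𝓡 n) : M → Type _) c).baseSet,
      Orientation.map (Fin n) ((trivializationAt (EuclideanSpace ℝ (Fin n))
        (TangentSpace (𝓡 n) : M → Type _) c).continuousLinearEquivAt ℝ x hx).toLinearEquiv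
        (orient x) = o₀

theorem finrank_tangent (x : M) : Module.finrank ℝ (TangentSpace (𝓡 n) x) = n :=
  finrank_euclideanSpace_fin (𝕜 := ℝ)

instance instFactFinrankTangent (x : M) : Fact (Module.finrank ℝ (TangentSpace (𝓡 n) x) = n) :=
  ⟨finrank_tangent x⟩

variable [RiemannianBundle (fun x : M => TangentSpace (𝓡 n) x)] [IsManifold (𝓡 n) ∞ M]

/-- The canonical volume form `μ` of the oriented Riemannian manifold `M`. -/
def volForm (o : ManifoldOrientation n M) (x : M) : TangentSpace (𝓡 n) x [⋀^Fin n]→ₗ[ℝ] ℝ :=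
  (o.orient x).volumeForm

/-- An orthonormal basis of the tangent space at `x`. -/
def orthoFrame (x : M) : OrthonormalBasis (Fin n) ℝ (TangentSpace (𝓡 n) x) :=
  (stdOrthonormalBasis ℝ (TangentSpace (𝓡 n) x)).reindex (finCongr (finrank_tangent x))

/-- The trace `∑ i, T(e_i, e_i)` of a bilinear form with respect to the metric. -/
def metricTrace {x : M} (T : TangentSpace (𝓡 n) x →L[ℝ] TangentSpace (𝓡 n) x →L[ℝ] ℝ) : ℝ :=
  ∑ i, T (orthoFrame x i) (orthoFrame x i)

/-- The Lie derivative `(L_Y μ)(v₁, …, vₙ) = Y(μ(V₁, …, Vₙ)) - ∑ i, μ(v₁, …, [Y, V_i], …, vₙ)` of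
the volume form at `x`, where `V_i` is a vector field that is smooth near `x` with value `v_i`
at `x`. -/
def lieDerivVol (o : ManifoldOrientation n M) (Y : ∀ x : M, TangentSpace (𝓡 n) x) (x : M)
    (v : Fin n → TangentSpace (𝓡 n) x) : ℝ :=
  let V : Fin n → ∀ p : M, TangentSpace (𝓡 n) p :=
    fun i => FiberBundle.extend (EuclideanSpace ℝ (Fin n)) (v i)
  mvfderiv (𝓡 n) (fun p => volForm o p (fun i => V i p)) x (Y x)
    - ∑ i, volForm o x (Function.update v i (mlieBracket (𝓡 n) Y (V i) x))

/-- The divergence of `Y`, i.e. the function with `L_Y μ = (div Y) μ`, computed by evaluating both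
sides on a basis of the tangent space. -/
def divergence (o : ManifoldOrientation n M) (Y : ∀ x : M, TangentSpace (𝓡 n) x) (x : M) : ℝ :=
  lieDerivVol o Y x (orthoFrame x) / volForm o x (orthoFrame x)

variable (n M) in
/-- A smooth partition of unity on `M` subordinate to the cover by chart domains. -/
def chartPartition [CompactSpace M] [T2Space M] :
    SmoothPartitionOfUnity M (𝓡 n) M Set.univ :=
  (SmoothPartitionOfUnity.exists_isSubordinate_chartAt_source (𝓡 n) M).choose

/-- The coordinate frame `∂₁, …, ∂ₙ` of the chart around `c`, at the point with coordinates `y`. -/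
def coordFrame (c : M) (y : EuclideanSpace ℝ (Fin n)) (i : Fin n) :
    TangentSpace (𝓡 n) ((extChartAt (𝓡 n) c).symm y) :=
  mfderiv 𝓘(ℝ, EuclideanSpace ℝ (Fin n)) (𝓡 n) (extChartAt (𝓡 n) c).symm y
    (EuclideanSpace.single i (1 : ℝ))

/-- The integral `∫_M η` of a top-degree form over the closed oriented manifold `M`, by means of a
partition of unity. The sign accounts for charts that do not preserve the orientation. -/
def integralForm [CompactSpace M] [T2Space M] (o : ManifoldOrientation n M)
    (η : ∀ x : M, TangentSpace (𝓡 n) x [⋀^Fin n]→ₗ[ℝ] ℝ) : ℝ :=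
  ∑ᶠ c : M, ∫ y in (extChartAt (𝓡 n) c).target,
    Real.sign (volForm o ((extChartAt (𝓡 n) c).symm y) (coordFrame c y)) *
      (chartPartition n M c ((extChartAt (𝓡 n) c).symm y) *
        η ((extChartAt (𝓡 n) c).symm y) (coordFrame c y))

/-- The integral `∫_M f μ` of a function against the canonical volume form. -/
def integralVol [CompactSpace M] [T2Space M] (o : ManifoldOrientation n M) (f : M → ℝ) : ℝ :=
  integralForm o (fun x => f x • volForm o x)

/-- The `L²` scalar product `∫_M g(X, Y) μ` of vector fields. -/
def l2Inner [CompactSpace M] [T2Space M] (o : ManifoldOrientation n M)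
    (X Y : ∀ x : M, TangentSpace (𝓡 n) x) : ℝ :=
  integralVol o (fun x => metricTensor (𝓡 n) x (X x) (Y x))

/-- `A` is the adjoint of `ad(X) = [X, ·]` on `𝔤` with respect to the `L²` scalar product. -/
def IsAdjointOfAd [CompactSpace M] [T2Space M] (o : ManifoldOrientation n M)
    (𝔤 : LieSubalgebra ℝ (VField n M)) (X : 𝔤) (A : 𝔤 →ₗ[ℝ] 𝔤) : Prop :=
  ∀ Z W : 𝔤, l2Inner o (A Z : VField n M) (W : VField n M) =
    l2Inner o (Z : VField n M) (⁅X, W⁆ : 𝔤).1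

variable [IsContMDiffRiemannianBundle (𝓡 n) ∞ (EuclideanSpace ℝ (Fin n))
    (fun x : M => TangentSpace (𝓡 n) x)]

/-- The symmetric 2-tensor field `(∇♭Y)^sym + (div Y) g`. -/
def symDivTensor (o : ManifoldOrientation n M) (Y : ∀ x : M, TangentSpace (𝓡 n) x) (x : M) :
    TangentSpace (𝓡 n) x →L[ℝ] TangentSpace (𝓡 n) x →L[ℝ] ℝ :=
  nablaFormSym (𝓡 n) (flat (𝓡 n) Y) x + divergence o Y x • metricTensor (𝓡 n) x

end Integration

end RiemGeom

end

/-!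
In coordinates, `div Y` is the Euclidean divergence of `√(det g) Y` divided by `√(det g)`; a
partition of unity turns this into the divergence theorem `∫ div Y μ = 0`. Since `∇` is metric and
torsion-free, also `div Y = tr ∇Y`.

Part (1): `Y g(X, X) = 2 g(∇_Y X, X)`, hence
`((∇♭Y)^sym + (div Y) g)(X, X) = 2 g(∇_X Y, X) + (div Y) g(X, X)` equals
`div (g(X, X) Y) + 2 g([X, Y], X)`, and the divergence integrates to zero.

Part (2): `tr (∇♭Y)^sym = 2 tr ∇Y`.

Part (3): a vanishing tensor has `(n + 2) div Y = 0`, hence `(∇♭Y)^sym = 0`. For the flow `Φ` of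
`Y`, the derivative of `s ↦ g(dΦ_s v, dΦ_s v)` at `t` is `2 g(∇_w Y, w)` with `w = dΦ_t v`, so the
flow is isometric exactly when `(∇♭Y)^sym = 0`. A global flow exists by compactness, and it is
smooth because, locally, the curves of the flow are the zeros of a smooth map on a space of
continuous curves, to which the implicit function theorem applies.
-/

noncomputable section

namespace RiemGeom

section GramVolume

variable {ι : Type*} [Fintype ι] [DecidableEq ι]

theorem hasFDerivAt_det {F : Type*} [NormedAddCommGroup F] [NormedSpace ℝ F]
    {G : F → Matrix ι ι ℝ} {G' : ι → ι → F →L[ℝ] ℝ} {x : F}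
    (h : ∀ i j, HasFDerivAt (fun y => G y i j) (G' i j) x) :
    HasFDerivAt (fun y => (G y).det) (∑ i, ∑ j, (G x).adjugate j i • G' i j) x := by
  let D : ContinuousMultilinearMap ℝ (fun _ : ι => ι → ℝ) ℝ :=
    { toMultilinearMap := (Matrix.detRowAlternating (n := ι) (R := ℝ)).toMultilinearMap
      cont := Continuous.matrix_det (A := fun A : Matrix ι ι ℝ => A) continuous_id }
  have hG : HasFDerivAt (fun y => (G y : ι → ι → ℝ))
      (ContinuousLinearMap.pi fun i => ContinuousLinearMap.pi fun j => G' i j) x :=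
    hasFDerivAt_pi.2 fun i => hasFDerivAt_pi.2 fun j => h i j
  refine ((D.hasFDerivAt (G x)).comp x hG).congr_fderiv ?_
  ext v
  have hcramer (i : ι) : D (Function.update (G x) i fun j => G' i j v) =
      ∑ j, (G x).adjugate j i * G' i j v := by
    have h := Matrix.cramer_transpose_apply (G x) (fun j => G' i j v) i
    rw [Matrix.cramer_eq_adjugate_mulVec, ← Matrix.adjugate_transpose] at h
    exact h.symm
  rw [ContinuousLinearMap.comp_apply]
  refine (D.linearDeriv_apply _ _).trans ?_
  simp only [_root_.sum_apply, _root_.smul_apply, smul_eq_mul]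
  exact Finset.sum_congr rfl fun i _ => hcramer i

section

variable {V : Type*} [NormedAddCommGroup V] [InnerProductSpace ℝ V]

/-- The volume of the parallelepiped spanned by `v`, computed as the square root of the Gram
determinant, so that no basis or orientation of the ambient space enters. -/
def gramVolume (v : ι → V) : ℝ := √(Matrix.gram ℝ v).det

theorem gramVolume_pos {v : ι → V} (hv : LinearIndependent ℝ v) : 0 < gramVolume v :=
  Real.sqrt_pos.2 (Matrix.posDef_gram_of_linearIndependent hv).det_pos

theorem gramVolume_sq {v : ι → V} (hv : LinearIndependent ℝ v) :
    gramVolume v ^ 2 = (Matrix.gram ℝ v).det :=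
  Real.sq_sqrt (Matrix.posDef_gram_of_linearIndependent hv).det_pos.le

theorem gramVolume_eq_abs_det (b : OrthonormalBasis ι ℝ V) (v : ι → V) :
    gramVolume v = |b.toBasis.det v| := by
  rw [gramVolume, Matrix.gram_eq_conjTranspose_mul b, Matrix.det_mul, Matrix.det_conjTranspose,
    star_trivial, Real.sqrt_mul_self_eq_abs]
  rfl

theorem gramVolume_comp_linearMap (b : OrthonormalBasis ι ℝ V) {W : Type*} [AddCommGroup W]
    [Module ℝ W] (e : Module.Basis ι ℝ W) (φ : W →ₗ[ℝ] V) (S : W →ₗ[ℝ] W) :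
    gramVolume (φ ∘ S ∘ e) = |LinearMap.det S| * gramVolume (φ ∘ e) := by
  rw [gramVolume_eq_abs_det b, gramVolume_eq_abs_det b, ← abs_mul]
  have h := congrArg (· (S ∘ e))
    (AlternatingMap.eq_smul_basis_det e (b.toBasis.det.compLinearMap φ))
  simp only [AlternatingMap.smul_apply, smul_eq_mul, AlternatingMap.compLinearMap_apply,
    Module.Basis.det_comp, Module.Basis.det_self, mul_one] at h
  exact congrArg _ (h.trans (mul_comm _ _))

theorem sum_adjugate_gram_mul (b : Module.Basis ι ℝ V) (L : V →ₗ[ℝ] V) :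
    ∑ i, ∑ j, (Matrix.gram ℝ b).adjugate j i *
        (inner ℝ (L (b i)) (b j) + inner ℝ (b i) (L (b j))) =
      2 * LinearMap.trace ℝ V L * (Matrix.gram ℝ b).det := by
  set G := Matrix.gram ℝ b with hG
  set l := LinearMap.toMatrix b b L with hl
  have hL (i : ι) : L (b i) = ∑ k, l k i • b k := by
    conv_lhs => rw [← b.sum_repr (L (b i))]
    simp only [hl, LinearMap.toMatrix_apply]
  have hentry (i j : ι) : inner ℝ (L (b i)) (b j) + inner ℝ (b i) (L (b j)) =
      (l.transpose * G + G * l) i j := by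
    rw [hL i, hL j, sum_inner, inner_sum]
    simp [Matrix.mul_apply, inner_smul_left, inner_smul_right, hG, Matrix.gram_apply, mul_comm]
  calc ∑ i, ∑ j, G.adjugate j i * (inner ℝ (L (b i)) (b j) + inner ℝ (b i) (L (b j)))
      = (G.adjugate * (l.transpose * G + G * l)).trace := by
        rw [Finset.sum_comm]
        simp only [hentry, Matrix.trace, Matrix.diag_apply, Matrix.mul_apply]
    _ = 2 * LinearMap.trace ℝ V L * G.det := by
        rw [mul_add, Matrix.trace_add, ← mul_assoc, Matrix.trace_mul_comm, ← mul_assoc,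
          Matrix.mul_adjugate, ← mul_assoc, Matrix.adjugate_mul,
          LinearMap.trace_eq_matrix_trace ℝ b, ← hl]
        simp only [Matrix.smul_mul, Matrix.one_mul, Matrix.trace_smul, Matrix.trace_transpose,
          smul_eq_mul]
        ring

theorem hasFDerivAt_sqrt_det_gram {F : Type*} [NormedAddCommGroup F] [NormedSpace ℝ F]
    {G : F → Matrix ι ι ℝ} {G' : ι → ι → F →L[ℝ] ℝ} {x : F} (b : Module.Basis ι ℝ V)
    (hb : G x = Matrix.gram ℝ b) (h : ∀ i j, HasFDerivAt (fun y => G y i j) (G' i j) x) :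
    ∃ A : F →L[ℝ] ℝ, HasFDerivAt (fun y => √(G y).det) A x ∧ ∀ (w : F) (L : V →ₗ[ℝ] V),
      (∀ i j, G' i j w = inner ℝ (L (b i)) (b j) + inner ℝ (b i) (L (b j))) →
      A w = LinearMap.trace ℝ V L * gramVolume b := by
  have hpos : 0 < gramVolume b := gramVolume_pos b.linearIndependent
  have hdet : (G x).det ≠ 0 := by
    rw [hb, ← gramVolume_sq b.linearIndependent]
    positivity
  refine ⟨_, (hasFDerivAt_det h).sqrt hdet, fun w L hL => ?_⟩
  have hsum := sum_adjugate_gram_mul b L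
  simp only [← hL, ← hb] at hsum
  simp only [_root_.smul_apply, _root_.sum_apply, smul_eq_mul, hsum]
  rw [hb, ← gramVolume_sq b.linearIndependent, Real.sqrt_sq hpos.le]
  field_simp

end

theorem sum_map_update_eq_trace_mul {R V : Type*} [CommRing R] [AddCommGroup V] [Module R V]
    (b : Module.Basis ι R V) (η : V [⋀^ι]→ₗ[R] R) (L : V →ₗ[R] V) :
    ∑ i, η (Function.update b i (L (b i))) = LinearMap.trace R V L * η b := by
  rw [LinearMap.trace_eq_matrix_trace R b, Matrix.trace, Finset.sum_mul]
  refine Finset.sum_congr rfl fun i _ => ?_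
  have hL : L (b i) = ∑ k, LinearMap.toMatrix b b L k i • b k := by
    conv_lhs => rw [← b.sum_repr (L (b i))]
    simp only [LinearMap.toMatrix_apply]
  rw [hL, AlternatingMap.map_update_sum, Finset.sum_eq_single i]
  · rw [AlternatingMap.map_update_smul, Function.update_eq_self, smul_eq_mul, Matrix.diag_apply]
  · intro k _ hk
    rw [AlternatingMap.map_update_smul, AlternatingMap.map_update_self _ _ hk.symm, smul_zero]
  · exact fun hi => absurd (Finset.mem_univ i) hi

end GramVolume

section Coordinates

variable {E : Type*} [NormedAddCommGroup E] [NormedSpace ℝ E]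
  {H : Type*} [TopologicalSpace H] {I : ModelWithCorners ℝ E H}
  {M : Type*} [TopologicalSpace M] [ChartedSpace H M]
  {F : Type*} [NormedAddCommGroup F] [NormedSpace ℝ F]

theorem mvfderiv_congr_of_eventuallyEq {p : M} {h₁ h₂ : M → F} (hh : h₁ =ᶠ[𝓝 p] h₂) :
    mvfderiv I h₁ p = mvfderiv I h₂ p := by
  ext v
  exact congrArg (fun A : E →L[ℝ] F => A v) hh.mfderiv_eq

variable [IsManifold I ∞ M]

variable (I) in
/-- The vector field with constant components `u` in the chart around `c`; it vanishes outside the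
chart domain. -/
def coordField (c : M) (u : E) (p : M) : TangentSpace I p :=
  (trivializationAt E (TangentSpace I : M → Type _) c).symmL ℝ p u

variable (I) in
/-- The components, in the chart around `c`, of the tangent vectors at `p`; it is zero for `p`
outside the chart domain. -/
def coordComp (c p : M) : TangentSpace I p →L[ℝ] E :=
  (trivializationAt E (TangentSpace I : M → Type _) c).continuousLinearMapAt ℝ p

variable (I) in
/-- The components of a vector field in the chart around `c`, as a function of the coordinates. -/
def coordRep (c : M) (Y : ∀ p : M, TangentSpace I p) (y : E) : E :=
  coordComp I c ((extChartAt I c).symm y) (Y ((extChartAt I c).symm y))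

variable {c p : M} {y : E} {Y : ∀ p : M, TangentSpace I p} {h : M → F}

theorem coordComp_coordField (hp : p ∈ (extChartAt I c).source) (u : E) :
    coordComp I c p (coordField I c u p) = u :=
  Trivialization.continuousLinearMapAt_symmL _ (by simpa using hp) _

theorem coordField_coordComp (hp : p ∈ (extChartAt I c).source) (v : TangentSpace I p) :
    coordField I c (coordComp I c p v) p = v :=
  Trivialization.symmL_continuousLinearMapAt _ (by simpa using hp) _

theorem coordComp_apply (hp : p ∈ (extChartAt I c).source) (v : TangentSpace I p) :
    coordComp I c p v = (trivializationAt E (TangentSpace I : M → Type _) c ⟨p, v⟩).2 := by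
  rw [coordComp, Trivialization.continuousLinearMapAt_apply, Trivialization.linearMapAt_apply,
    if_pos (by simpa using hp)]

theorem coordComp_eq_mfderiv (hp : p ∈ (extChartAt I c).source) :
    coordComp I c p = mfderiv I 𝓘(ℝ, E) (extChartAt I c) p :=
  TangentBundle.continuousLinearMapAt_trivializationAt (by simpa using hp)

theorem contMDiffAt_coordField (hp : p ∈ (extChartAt I c).source) (u : E) :
    CMDiffAt ∞ (T% (coordField I c u)) p := by
  rw [Trivialization.contMDiffAt_section_iff (IB := I)
    (trivializationAt E (TangentSpace I : M → Type _) c) (by simpa using hp)]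
  refine (contMDiffAt_const (c := u)).congr_of_eventuallyEq ?_
  filter_upwards [(isOpen_extChartAt_source c).mem_nhds hp] with q hq
  rw [← coordComp_apply hq, coordComp_coordField hq]

theorem mdifferentiableAt_coordField (hp : p ∈ (extChartAt I c).source) (u : E) :
    MDiffAt (T% (coordField I c u)) p :=
  (contMDiffAt_coordField hp u).mdifferentiableAt (by simp)

theorem continuousAt_coordComp (hp : p ∈ (extChartAt I c).source) (hY : MDiffAt (T% Y) p) :
    ContinuousAt (fun q => coordComp I c q (Y q)) p := by
  have htriv := (Trivialization.mdifferentiableAt_section_iff I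
    (trivializationAt E (TangentSpace I : M → Type _) c) Y (by simpa using hp)).1 hY
  refine htriv.continuousAt.congr ?_
  filter_upwards [(isOpen_extChartAt_source c).mem_nhds hp] with q hq
  rw [← coordComp_apply hq]

section Boundaryless

variable [I.Boundaryless]

theorem coordField_symm (hy : y ∈ (extChartAt I c).target) (u : E) :
    coordField I c u ((extChartAt I c).symm y) =
      mfderiv 𝓘(ℝ, E) I (extChartAt I c).symm y u := by
  have hp := (extChartAt I c).map_target hy
  rw [coordField, TangentBundle.symmL_trivializationAt (by simpa using hp),
    (extChartAt I c).right_inv hy]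
  simp only [ModelWithCorners.Boundaryless.range_eq_univ, mfderivWithin_univ]
  rfl

theorem contMDiffAt_extChartAt_symm (hy : y ∈ (extChartAt I c).target) :
    CMDiffAt ∞ (extChartAt I c).symm y :=
  (contMDiffOn_extChartAt_symm c).contMDiffAt ((isOpen_extChartAt_target c).mem_nhds hy)

theorem contDiffAt_coordRep {k : ℕ∞} (hy : y ∈ (extChartAt I c).target)
    (hY : CMDiffAt k (T% Y) ((extChartAt I c).symm y)) :
    ContDiffAt ℝ k (coordRep I c Y) y := by
  have hp := (extChartAt I c).map_target hy
  have : IsManifold I ((k : WithTop ℕ∞) + 1) M := .of_le (n := ∞) (by exact_mod_cast le_top)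
  rw [Trivialization.contMDiffAt_section_iff (IB := I)
    (trivializationAt E (TangentSpace I : M → Type _) c) (by simpa using hp)] at hY
  have hcomp := hY.comp y ((contMDiffAt_extChartAt_symm hy).of_le (by exact_mod_cast le_top))
  refine (contMDiffAt_iff_contDiffAt.1 hcomp).congr_of_eventuallyEq ?_
  filter_upwards [(isOpen_extChartAt_target c).mem_nhds hy] with z hz
  exact coordComp_apply ((extChartAt I c).map_target hz) _

theorem differentiableAt_comp_symm (hp : p ∈ (extChartAt I c).source) (hh : MDiffAt h p) :
    DifferentiableAt ℝ (h ∘ (extChartAt I c).symm) (extChartAt I c p) := by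
  rw [← mdifferentiableAt_iff_differentiableAt]
  have hs := (contMDiffAt_extChartAt_symm
    ((extChartAt I c).map_source hp)).mdifferentiableAt (by simp)
  exact MDifferentiableAt.comp_of_eq (x := extChartAt I c p) hh hs ((extChartAt I c).left_inv hp)

theorem mvfderiv_coordField (hp : p ∈ (extChartAt I c).source) (hh : MDiffAt h p) (u : E) :
    mvfderiv I h p (coordField I c u p) =
      fderiv ℝ (h ∘ (extChartAt I c).symm) (extChartAt I c p) u := by
  obtain ⟨y, hy, rfl⟩ : ∃ y ∈ (extChartAt I c).target, (extChartAt I c).symm y = p :=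
    ⟨_, (extChartAt I c).map_source hp, (extChartAt I c).left_inv hp⟩
  have hs := (contMDiffAt_extChartAt_symm hy).mdifferentiableAt (by simp)
  rw [coordField_symm hy, (extChartAt I c).right_inv hy, ← mfderiv_eq_fderiv,
    mfderiv_comp y hh hs]
  rfl

theorem mvfderiv_eq_fderiv_coordComp (hp : p ∈ (extChartAt I c).source) (hh : MDiffAt h p)
    (v : TangentSpace I p) :
    mvfderiv I h p v =
      fderiv ℝ (h ∘ (extChartAt I c).symm) (extChartAt I c p) (coordComp I c p v) := by
  conv_lhs => rw [← coordField_coordComp hp v]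
  exact mvfderiv_coordField hp hh _

theorem mfderiv_extChartAt_symm_inverse_apply (hy : y ∈ (extChartAt I c).target)
    (v : TangentSpace I ((extChartAt I c).symm y)) :
    (mfderiv 𝓘(ℝ, E) I (extChartAt I c).symm y).inverse v =
      coordComp I c ((extChartAt I c).symm y) v := by
  have hinv := isInvertible_mfderivWithin_extChartAt_symm (I := I) hy
  simp only [ModelWithCorners.Boundaryless.range_eq_univ, mfderivWithin_univ] at hinv
  have hv := coordField_symm hy (coordComp I c ((extChartAt I c).symm y) v)
  rw [coordField_coordComp ((extChartAt I c).map_target hy)] at hv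
  conv_lhs => rw [hv]
  exact hinv.inverse_apply_self _

theorem mlieBracket_eq_lieBracket (V W : ∀ x : E, TangentSpace 𝓘(ℝ, E) x) (x : E) :
    mlieBracket 𝓘(ℝ, E) V W x = lieBracket ℝ V W x := by
  rw [← mlieBracketWithin_univ, mlieBracketWithin_eq_lieBracketWithin]
  exact congrFun lieBracketWithin_univ x

theorem mpullback_extChartAt_symm_eventuallyEq (hy : y ∈ (extChartAt I c).target)
    (Y : ∀ p : M, TangentSpace I p) :
    mpullback 𝓘(ℝ, E) I (extChartAt I c).symm Y =ᶠ[𝓝 y] coordRep I c Y := by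
  filter_upwards [(isOpen_extChartAt_target c).mem_nhds hy] with z hz
  exact mfderiv_extChartAt_symm_inverse_apply hz _

theorem mlieBracket_coordField [CompleteSpace E] (hp : p ∈ (extChartAt I c).source)
    (hY : MDiffAt (T% Y) p) (u : E) :
    mlieBracket I (coordField I c u) Y p =
      coordField I c (fderiv ℝ (coordRep I c Y) (extChartAt I c p) u) p := by
  obtain ⟨y, hy, rfl⟩ : ∃ y ∈ (extChartAt I c).target, (extChartAt I c).symm y = p :=
    ⟨_, (extChartAt I c).map_source hp, (extChartAt I c).left_inv hp⟩
  rw [(extChartAt I c).right_inv hy]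
  have : IsManifold I (minSmoothness ℝ 2) M := by
    simp only [minSmoothness_of_isRCLikeNormedField]
    infer_instance
  have hpull := mpullback_mlieBracket (I := 𝓘(ℝ, E)) (I' := I)
    (mdifferentiableAt_coordField hp u) hY (contMDiffAt_extChartAt_symm hy)
    (by simpa using (ENat.LEInfty.out : (2 : WithTop ℕ∞) ≤ ∞))
  rw [mpullback_apply, mfderiv_extChartAt_symm_inverse_apply hy] at hpull
  have hconst : coordRep I c (coordField I c u) =ᶠ[𝓝 y] fun _ => u := by
    filter_upwards [(isOpen_extChartAt_target c).mem_nhds hy] with z hz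
    exact coordComp_coordField ((extChartAt I c).map_target hz) u
  have hbracket : coordComp I c ((extChartAt I c).symm y)
      (mlieBracket I (coordField I c u) Y ((extChartAt I c).symm y)) =
      lieBracket ℝ (fun _ : E => u) (coordRep I c Y) y :=
    (hpull.trans (mlieBracket_eq_lieBracket _ _ _)).trans <|
      Filter.EventuallyEq.lieBracket_vectorField_eq (𝕜 := ℝ) (E := E)
        ((mpullback_extChartAt_symm_eventuallyEq hy _).trans hconst)
        (mpullback_extChartAt_symm_eventuallyEq hy Y)
  simp only [lieBracket, fderiv_fun_const, Pi.zero_apply, _root_.zero_apply,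
    sub_zero] at hbracket
  rw [← hbracket]
  exact (coordField_coordComp hp _).symm

end Boundaryless

theorem mdifferentiableAt_of_comp_symm (hp : p ∈ (extChartAt I c).source)
    (hh : DifferentiableAt ℝ (h ∘ (extChartAt I c).symm) (extChartAt I c p)) : MDiffAt h p := by
  have hs := mdifferentiableAt_extChartAt (I := I) (x := c) (y := p) (by simpa using hp)
  refine (hh.mdifferentiableAt.comp p hs).congr_of_eventuallyEq ?_
  filter_upwards [(isOpen_extChartAt_source (I := I) c).mem_nhds hp] with q hq
  simp only [Function.comp_apply, (extChartAt I c).left_inv hq]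

end Coordinates

section VolumeForm

theorem sign_mul_of_pos {r : ℝ} (hr : 0 < r) (a : ℝ) : Real.sign (r * a) = Real.sign a := by
  rcases lt_trichotomy a 0 with h | rfl | h
  · rw [Real.sign_of_neg h, Real.sign_of_neg (mul_neg_of_pos_of_neg hr h)]
  · rw [mul_zero]
  · rw [Real.sign_of_pos h, Real.sign_of_pos (mul_pos hr h)]

theorem sign_mul_abs_self (a : ℝ) : Real.sign a * |a| = a := by
  rcases lt_trichotomy a 0 with h | rfl | h
  · rw [Real.sign_of_neg h, abs_of_neg h]; ring
  · simp
  · rw [Real.sign_of_pos h, abs_of_pos h, one_mul]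

theorem sign_mul_self_eq_abs (a : ℝ) : Real.sign a * a = |a| := by
  rcases lt_trichotomy a 0 with h | rfl | h
  · rw [Real.sign_of_neg h, abs_of_neg h]; ring
  · simp
  · rw [Real.sign_of_pos h, abs_of_pos h, one_mul]

theorem eventually_sign_eq {X : Type*} [TopologicalSpace X] {f : X → ℝ} {x : X}
    (hf : ContinuousAt f x) (h0 : f x ≠ 0) :
    ∀ᶠ y in 𝓝 x, Real.sign (f y) = Real.sign (f x) := by
  rcases lt_or_gt_of_ne h0 with h | h
  · filter_upwards [hf.eventually_lt_const h] with y hy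
    rw [Real.sign_of_neg hy, Real.sign_of_neg h]
  · filter_upwards [hf.eventually_const_lt h] with y hy
    rw [Real.sign_of_pos hy, Real.sign_of_pos h]

theorem orientation_eq_rayOfNeZero_volumeForm {n : ℕ} {V : Type*} [NormedAddCommGroup V]
    [InnerProductSpace ℝ V] [Fact (Module.finrank ℝ V = n)] (o : Orientation ℝ V (Fin n)) :
    ∃ h : o.volumeForm ≠ 0, o = rayOfNeZero ℝ o.volumeForm h := by
  rcases n with - | n
  · have h1 : (AlternatingMap.constLinearEquivOfIsEmpty (1 : ℝ) : V [⋀^Fin 0]→ₗ[ℝ] ℝ) ≠ 0 :=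
      AlternatingMap.constLinearEquivOfIsEmpty.injective.ne one_ne_zero
    rcases o.eq_or_eq_neg_of_isEmpty with rfl | rfl
    · simp only [Orientation.volumeForm_zero_pos]
      exact ⟨h1, rfl⟩
    · simp only [Orientation.volumeForm_zero_neg]
      exact ⟨neg_ne_zero.2 h1, neg_rayOfNeZero ℝ _ h1⟩
  · have hb := o.finOrthonormalBasis_orientation n.succ_pos Fact.out
    rw [o.volumeForm_robust _ hb]
    exact ⟨Module.Basis.det_ne_zero _, hb.symm⟩

theorem continuous_alternatingMap {ι V : Type*} [Finite ι] [NormedAddCommGroup V]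
    [NormedSpace ℝ V] (b : Module.Basis ι ℝ V) (η : V [⋀^ι]→ₗ[ℝ] ℝ) : Continuous η := by
  classical
  cases nonempty_fintype ι
  have : FiniteDimensional ℝ V := b.finiteDimensional_of_finite
  have hη : ⇑η = fun v => η b * (b.toMatrix v).det :=
    congrArg DFunLike.coe (AlternatingMap.eq_smul_basis_det b η)
  rw [hη]
  refine continuous_const.mul (Continuous.matrix_det ?_)
  refine continuous_pi fun i => continuous_pi fun j => ?_
  exact (b.coord i).continuous_of_finiteDimensional.comp (continuous_apply j)

variable {n : ℕ} {M : Type*} [TopologicalSpace M] [ChartedSpace (EuclideanSpace ℝ (Fin n)) M]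
  [IsManifold (𝓡 n) ∞ M] [RiemannianBundle (fun x : M => TangentSpace (𝓡 n) x)]
  (o : ManifoldOrientation n M)

theorem abs_volForm (p : M) (v : Fin n → TangentSpace (𝓡 n) p) :
    |volForm o p v| = gramVolume v := by
  rw [volForm, (o.orient p).volumeForm_robust' (orthoFrame p),
    gramVolume_eq_abs_det (orthoFrame p)]

theorem sign_volForm_mul_gramVolume (p : M) (v : Fin n → TangentSpace (𝓡 n) p) :
    Real.sign (volForm o p v) * gramVolume v = volForm o p v := by
  rw [← abs_volForm o p v, sign_mul_abs_self]

theorem exists_eventually_volForm_eq_pos_mul (x : M) :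
    ∃ η : EuclideanSpace ℝ (Fin n) [⋀^Fin n]→ₗ[ℝ] ℝ, ∀ᶠ p in 𝓝 x, ∃ r > 0,
      ∀ v : Fin n → TangentSpace (𝓡 n) p,
        volForm o p v = r * η (fun i => coordComp (𝓡 n) x p (v i)) := by
  obtain ⟨o₀, ho⟩ := o.locallyConstant x
  induction o₀ using Module.Ray.ind with | h η hη => ?_
  refine ⟨η, ?_⟩
  filter_upwards [ho, (isOpen_extChartAt_source x).mem_nhds (mem_extChartAt_source (I := 𝓡 n) x)]
    with p hp hpx
  have hbase : p ∈ (trivializationAt (EuclideanSpace ℝ (Fin n))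
    (TangentSpace (𝓡 n) : M → Type _) x).baseSet := by simpa using hpx
  obtain ⟨hne, horient⟩ := orientation_eq_rayOfNeZero_volumeForm (o.orient p)
  specialize hp hbase
  rw [horient, Orientation.map_apply, ray_eq_iff] at hp
  obtain ⟨r, hr, hmap⟩ := hp.symm.exists_pos_left hη
    (mt (AlternatingMap.compLinearEquiv_eq_zero_iff _ _).mp hne)
  refine ⟨r, hr, fun v => ?_⟩
  have happly := congrArg (fun ζ => ζ (fun i => coordComp (𝓡 n) x p (v i))) hmap
  simp only [AlternatingMap.smul_apply, smul_eq_mul, AlternatingMap.compLinearMap_apply] at happly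
  rw [happly]
  change (o.orient p).volumeForm v = (o.orient p).volumeForm _
  congr 1
  ext1 i
  have hsymm := congrFun (Trivialization.symm_continuousLinearEquivAt_eq (R := ℝ) _ hbase)
    (coordComp (𝓡 n) x p (v i))
  exact (coordField_coordComp hpx _).symm.trans hsymm.symm

variable {x : M} {V : Fin n → ∀ p : M, TangentSpace (𝓡 n) p}

theorem eventually_sign_volForm_eq
    (hV : ∀ i, MDifferentiableAt (𝓡 n) (𝓡 n).tangent (T% (V i)) x)
    (h0 : volForm o x (fun i => V i x) ≠ 0) :
    ∀ᶠ p in 𝓝 x, Real.sign (volForm o p fun i => V i p) =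
      Real.sign (volForm o x fun i => V i x) := by
  obtain ⟨η, hη⟩ := exists_eventually_volForm_eq_pos_mul o x
  obtain ⟨r₀, hr₀, hx⟩ := hη.self_of_nhds
  have hcont : ContinuousAt (fun p => η (fun i => coordComp (𝓡 n) x p (V i p))) x :=
    (continuous_alternatingMap
      (EuclideanSpace.basisFun (Fin n) ℝ).toBasis η).continuousAt.comp <|
      continuousAt_pi.2 fun i => continuousAt_coordComp (mem_extChartAt_source x) (hV i)
  have hηx : η (fun i => coordComp (𝓡 n) x x (V i x)) ≠ 0 := fun h =>
    h0 (by rw [hx, h, mul_zero])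
  filter_upwards [hη, eventually_sign_eq hcont hηx] with p ⟨r, hr, hp⟩ hsign
  rw [hp, hx, sign_mul_of_pos hr, sign_mul_of_pos hr₀, hsign]

theorem eventually_volForm_eq_sign_mul
    (hV : ∀ i, MDifferentiableAt (𝓡 n) (𝓡 n).tangent (T% (V i)) x)
    (h0 : volForm o x (fun i => V i x) ≠ 0) :
    ∀ᶠ p in 𝓝 x, volForm o p (fun i => V i p) =
      Real.sign (volForm o x fun i => V i x) * gramVolume fun i => V i p := by
  filter_upwards [eventually_sign_volForm_eq o hV h0] with p hp
  rw [← hp, sign_volForm_mul_gramVolume]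

end VolumeForm

section LeviCivitaProperties

variable {E : Type*} [NormedAddCommGroup E] [NormedSpace ℝ E]
  {H : Type*} [TopologicalSpace H] {I : ModelWithCorners ℝ E H}
  {M : Type*} [TopologicalSpace M] [ChartedSpace H M] [IsManifold I ∞ M]
  [RiemannianBundle (fun x : M => TangentSpace I x)]
  [IsContMDiffRiemannianBundle I ∞ E (fun x : M => TangentSpace I x)]
  {x : M} {X Y Z : ∀ p : M, TangentSpace I p}
  {ι : Type*} {V : ι → ∀ p : M, TangentSpace I p}
  {b : Module.Basis ι ℝ (TangentSpace I x)}

theorem oneFormDiffAt_flat (hY : MDiffAt (T% Y) x) : OneFormDiffAt I (flat I Y) x := by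
  obtain ⟨g, hg, hinner⟩ := IsContMDiffRiemannianBundle.exists_contMDiff (IB := I) (n := ∞)
    (F := E) (E := fun x : M => TangentSpace I x)
  have hflat (p : M) : flat I Y p = g p (Y p) := by
    ext v
    exact hinner p (Y p) v
  simp only [OneFormDiffAt, hflat]
  exact MDifferentiableAt.clm_bundle_apply (F₁ := E) (F₂ := E →L[ℝ] ℝ)
    (E₁ := fun x : M => TangentSpace I x)
    (E₂ := fun x : M => TangentSpace I x →L[ℝ] Bundle.Trivial M ℝ x)
    (b := fun p : M => p) ((hg x).mdifferentiableAt (by simp)) hY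

theorem contMDiff_inner {k : ℕ∞} (hY : ContMDiff I I.tangent k (T% Y))
    (hZ : ContMDiff I I.tangent k (T% Z)) :
    ContMDiff I 𝓘(ℝ, ℝ) k fun p => (inner ℝ (Y p) (Z p) : ℝ) := by
  have : IsContMDiffRiemannianBundle I k E (fun x : M => TangentSpace I x) :=
    .of_le (n := ∞) (mod_cast le_top)
  exact ContMDiff.inner_bundle (IB := I) (F := E) (E := fun x : M => TangentSpace I x) hY hZ

theorem mdifferentiableAt_gramVolume [Fintype ι] [DecidableEq ι] [I.Boundaryless]
    (hV : ∀ i, MDiffAt (T% (V i)) x) (hb : ⇑b = fun i => V i x) :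
    MDiffAt (fun p => gramVolume fun i => V i p) x := by
  have hx : x ∈ (extChartAt I x).source := mem_extChartAt_source x
  obtain ⟨A, hA, -⟩ := hasFDerivAt_sqrt_det_gram (x := extChartAt I x x) b
    (G := fun y => Matrix.gram ℝ fun i => V i ((extChartAt I x).symm y))
    (by rw [extChartAt_to_inv, hb]) fun i j =>
      (differentiableAt_comp_symm hx (mdiffAt_inner (hV i) (hV j))).hasFDerivAt
  exact mdifferentiableAt_of_comp_symm hx hA.differentiableAt

variable [FiniteDimensional ℝ E]

theorem mvfderiv_inner (hY : MDiffAt (T% Y) x) (hZ : MDiffAt (T% Z) x) (w : TangentSpace I x) :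
    mvfderiv I (fun p => (inner ℝ (Y p) (Z p) : ℝ)) x w =
      inner ℝ (nabla I Y x w) (Z x) + inner ℝ (Y x) (nabla I Z x w) := by
  have hw : MDiffAt (T% (FiberBundle.extend E w)) x := FiberBundle.mdifferentiableAt_extend ..
  have h := leviCivita_inner hw hY hZ
  rwa [FiberBundle.extend_apply_self] at h

theorem mlieBracket_eq_nabla_sub_nabla (hX : MDiffAt (T% X) x) (hY : MDiffAt (T% Y) x) :
    mlieBracket I X Y x = nabla I Y x (X x) - nabla I X x (Y x) := by
  have : CompleteSpace E := FiniteDimensional.complete ℝ E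
  exact ((CovariantDerivative.torsion_eq_zero_iff _).1
    (leviCivita_torsion (I := I) (M := M)) hX hY).symm

theorem nablaForm_flat_apply (hY : MDiffAt (T% Y) x) (v w : TangentSpace I x) :
    nablaForm I (flat I Y) x v w = inner ℝ (nabla I Y x v) w := by
  have hw : MDiffAt (T% (FiberBundle.extend E w)) x := FiberBundle.mdifferentiableAt_extend ..
  have hinner := mvfderiv_inner hY hw v
  have happly := TensorialAt.mkHom_apply (nablaForm_tensorial (oneFormDiffAt_flat hY)) hw
  rw [FiberBundle.extend_apply_self] at hinner happly
  rw [nablaForm, dif_pos (oneFormDiffAt_flat hY), ContinuousLinearMap.flip_apply, happly]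
  exact sub_eq_of_eq_add hinner

theorem nablaFormSym_flat_apply (hY : MDiffAt (T% Y) x) (v w : TangentSpace I x) :
    nablaFormSym I (flat I Y) x v w =
      inner ℝ (nabla I Y x v) w + inner ℝ (nabla I Y x w) v := by
  rw [← nablaForm_flat_apply hY, ← nablaForm_flat_apply hY]
  rfl

theorem nablaFormSym_flat_eq_zero_iff (hY : MDiffAt (T% Y) x) :
    nablaFormSym I (flat I Y) x = 0 ↔
      ∀ v : TangentSpace I x, inner ℝ (nabla I Y x v) v = 0 := by
  refine ⟨fun h v => ?_, fun h => ?_⟩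
  · have hv : nablaFormSym I (flat I Y) x v v = 0 := by rw [h]; rfl
    rw [nablaFormSym_flat_apply hY] at hv
    linarith
  · ext v w
    have hvw := h (v + w)
    rw [map_add, inner_add_left, inner_add_right, inner_add_right, h v, h w] at hvw
    rw [nablaFormSym_flat_apply hY]
    simpa using hvw

theorem trace_constr_nabla (hY : MDiffAt (T% Y) x) (hV : ∀ i, MDiffAt (T% (V i)) x)
    (hb : ⇑b = fun i => V i x) :
    LinearMap.trace ℝ _ (b.constr ℝ fun i => nabla I (V i) x (Y x)) =
      LinearMap.trace ℝ _ (nabla I Y x).toLinearMap +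
        LinearMap.trace ℝ _ (b.constr ℝ fun i => mlieBracket I Y (V i) x) := by
  rw [← map_add]
  congr 1
  refine b.ext fun i => ?_
  rw [LinearMap.add_apply, b.constr_basis, b.constr_basis,
    mlieBracket_eq_nabla_sub_nabla hY (hV i), congrFun hb i]
  exact (add_sub_cancel _ _).symm

theorem mvfderiv_gramVolume [Fintype ι] [DecidableEq ι] [I.Boundaryless]
    (hV : ∀ i, MDiffAt (T% (V i)) x) (hb : ⇑b = fun i => V i x)
    (w : TangentSpace I x) :
    mvfderiv I (fun p => gramVolume fun i => V i p) x w =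
      LinearMap.trace ℝ _ (b.constr ℝ fun i => nabla I (V i) x w) * gramVolume b := by
  have hx : x ∈ (extChartAt I x).source := mem_extChartAt_source x
  obtain ⟨A, hA, htrace⟩ := hasFDerivAt_sqrt_det_gram (x := extChartAt I x x) b
    (G := fun y => Matrix.gram ℝ fun i => V i ((extChartAt I x).symm y))
    (by rw [extChartAt_to_inv, hb]) fun i j =>
      (differentiableAt_comp_symm hx (mdiffAt_inner (hV i) (hV j))).hasFDerivAt
  rw [mvfderiv_eq_fderiv_coordComp hx (mdifferentiableAt_gramVolume hV hb)]
  refine (congrArg (fun A => A (coordComp I x x w)) hA.fderiv).trans (htrace _ _ fun i j => ?_)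
  rw [← mvfderiv_eq_fderiv_coordComp hx (mdiffAt_inner (hV i) (hV j)),
    mvfderiv_inner (hV i) (hV j), b.constr_basis, b.constr_basis, hb]

end LeviCivitaProperties

section Divergence

variable {n : ℕ} {M : Type*} [TopologicalSpace M] [ChartedSpace (EuclideanSpace ℝ (Fin n)) M]
  [RiemannianBundle (fun x : M => TangentSpace (𝓡 n) x)] {x : M}

theorem metricTrace_metricTensor : metricTrace (metricTensor (𝓡 n) x) = n := by
  simp only [metricTrace, metricTensor_apply, real_inner_self_eq_norm_sq,
    (orthoFrame (n := n) x).norm_eq_one]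
  simp

variable [IsManifold (𝓡 n) ∞ M]
  [IsContMDiffRiemannianBundle (𝓡 n) ∞ (EuclideanSpace ℝ (Fin n))
    (fun x : M => TangentSpace (𝓡 n) x)]
  (o : ManifoldOrientation n M) {Y : ∀ p : M, TangentSpace (𝓡 n) p}

theorem mvfderiv_volForm {V : Fin n → ∀ p : M, TangentSpace (𝓡 n) p}
    {b : Module.Basis (Fin n) ℝ (TangentSpace (𝓡 n) x)}
    (hV : ∀ i, MDifferentiableAt (𝓡 n) (𝓡 n).tangent (T% (V i)) x) (hb : ⇑b = fun i => V i x)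
    (w : TangentSpace (𝓡 n) x) :
    mvfderiv (𝓡 n) (fun p => volForm o p fun i => V i p) x w =
      LinearMap.trace ℝ _ (b.constr ℝ fun i => nabla (𝓡 n) (V i) x w) * volForm o x b := by
  have h0 : volForm o x (fun i => V i x) ≠ 0 := by
    rw [← abs_pos, abs_volForm, ← hb]
    exact gramVolume_pos b.linearIndependent
  rw [mvfderiv_congr_of_eventuallyEq (eventually_volForm_eq_sign_mul o hV h0),
    mvfderiv_fun_mul mdifferentiableAt_const (mdifferentiableAt_gramVolume hV hb), mvfderiv_const,
    ← sign_volForm_mul_gramVolume o x b]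
  simp only [smul_zero, add_zero, _root_.smul_apply, smul_eq_mul, mvfderiv_gramVolume hV hb, hb]
  ring

theorem divergence_eq_trace_nabla
    (hY : MDifferentiableAt (𝓡 n) (𝓡 n).tangent (T% Y) x) :
    divergence o Y x = LinearMap.trace ℝ _ (nabla (𝓡 n) Y x).toLinearMap := by
  set b := (orthoFrame (n := n) x).toBasis with hbdef
  let V (i : Fin n) : ∀ p : M, TangentSpace (𝓡 n) p :=
    FiberBundle.extend (EuclideanSpace ℝ (Fin n)) (orthoFrame x i)
  have hV (i : Fin n) : MDifferentiableAt (𝓡 n) (𝓡 n).tangent (T% (V i)) x :=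
    FiberBundle.mdifferentiableAt_extend ..
  have hb : ⇑b = fun i => V i x := by
    ext1 i
    rw [hbdef, OrthonormalBasis.coe_toBasis]
    exact (FiberBundle.extend_apply_self (EuclideanSpace ℝ (Fin n)) (orthoFrame x i)).symm
  have h0 : volForm o x b ≠ 0 := by
    rw [← abs_pos, abs_volForm]
    exact gramVolume_pos b.linearIndependent
  have hsum := sum_map_update_eq_trace_mul b (volForm o x)
    (b.constr ℝ fun i => mlieBracket (𝓡 n) Y (V i) x)
  simp only [b.constr_basis] at hsum
  rw [divergence, ← OrthonormalBasis.coe_toBasis, ← hbdef, div_eq_iff h0, lieDerivVol]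
  refine (congrArg₂ (· - ·) (mvfderiv_volForm o hV hb (Y x)) hsum).trans ?_
  rw [trace_constr_nabla hY hV hb]
  ring

theorem metricTrace_nablaFormSym_flat (hY : MDifferentiableAt (𝓡 n) (𝓡 n).tangent (T% Y) x) :
    metricTrace (nablaFormSym (𝓡 n) (flat (𝓡 n) Y) x) = 2 * divergence o Y x := by
  rw [divergence_eq_trace_nabla o hY, LinearMap.trace_eq_sum_inner _ (orthoFrame x), metricTrace,
    Finset.mul_sum]
  refine Finset.sum_congr rfl fun i _ => ?_
  rw [nablaFormSym_flat_apply hY, real_inner_comm, two_mul]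
  rfl

theorem metricTrace_symDivTensor (hY : MDifferentiableAt (𝓡 n) (𝓡 n).tangent (T% Y) x) :
    metricTrace (symDivTensor o Y x) = (n + 2) * divergence o Y x := by
  have hsplit : metricTrace (symDivTensor o Y x) =
      metricTrace (nablaFormSym (𝓡 n) (flat (𝓡 n) Y) x) +
        divergence o Y x * metricTrace (metricTensor (𝓡 n) x) := by
    simp only [metricTrace, Finset.mul_sum, ← Finset.sum_add_distrib]
    rfl
  rw [hsplit, metricTrace_nablaFormSym_flat o hY, metricTrace_metricTensor]
  ring

-- The traces of the two tensors are nonzero multiples of `div Y`.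
theorem symDivTensor_eq_zero_iff (hY : MDifferentiableAt (𝓡 n) (𝓡 n).tangent (T% Y) x) :
    symDivTensor o Y x = 0 ↔ nablaFormSym (𝓡 n) (flat (𝓡 n) Y) x = 0 := by
  have htrace_zero :
      metricTrace (0 : TangentSpace (𝓡 n) x →L[ℝ] TangentSpace (𝓡 n) x →L[ℝ] ℝ) = 0 :=
    Finset.sum_eq_zero fun _ _ => rfl
  have heq (h : divergence o Y x = 0) :
      symDivTensor o Y x = nablaFormSym (𝓡 n) (flat (𝓡 n) Y) x := by
    ext v w
    simp [symDivTensor, h]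
  refine ⟨fun h => ?_, fun h => ?_⟩
  · have htrace := metricTrace_symDivTensor o hY
    rw [h, htrace_zero, zero_eq_mul, or_iff_right (by positivity)] at htrace
    rw [← heq htrace, h]
  · have htrace := metricTrace_nablaFormSym_flat o hY
    rw [h, htrace_zero, zero_eq_mul, or_iff_right two_ne_zero] at htrace
    rw [heq htrace, h]

end Divergence

section Density

theorem trace_fderiv_smul {E : Type*} [NormedAddCommGroup E] [NormedSpace ℝ E]
    [FiniteDimensional ℝ E] {f : E → ℝ} {g : E → E} {x : E} (hf : DifferentiableAt ℝ f x)
    (hg : DifferentiableAt ℝ g x) :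
    LinearMap.trace ℝ E (fderiv ℝ (fun z => f z • g z) x).toLinearMap =
      fderiv ℝ f x (g x) + f x * LinearMap.trace ℝ E (fderiv ℝ g x).toLinearMap := by
  rw [fderiv_fun_smul hf hg, ContinuousLinearMap.toLinearMap_add,
    ContinuousLinearMap.toLinearMap_smul, map_add, map_smul, smul_eq_mul, add_comm]
  exact congrArg (· + _) (LinearMap.trace_smulRight (fderiv ℝ f x).toLinearMap (g x))

variable {n : ℕ} {M : Type*} [TopologicalSpace M] [ChartedSpace (EuclideanSpace ℝ (Fin n)) M]
  [IsManifold (𝓡 n) ∞ M] {c d p : M} {y : EuclideanSpace ℝ (Fin n)}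

/-- The isomorphism from coordinates to tangent vectors at `p` given by the chart around `c`. -/
def coordEquiv (hp : p ∈ (extChartAt (𝓡 n) c).source) :
    EuclideanSpace ℝ (Fin n) ≃ₗ[ℝ] TangentSpace (𝓡 n) p where
  toFun u := coordField (𝓡 n) c u p
  map_add' := map_add _
  map_smul' := map_smul _
  invFun := coordComp (𝓡 n) c p
  left_inv := coordComp_coordField hp
  right_inv := coordField_coordComp hp

/-- The coordinate vectors of the chart around `c`, as a basis of the tangent space at `p`. -/
def coordBasis (hp : p ∈ (extChartAt (𝓡 n) c).source) :
    Module.Basis (Fin n) ℝ (TangentSpace (𝓡 n) p) :=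
  (EuclideanSpace.basisFun (Fin n) ℝ).toBasis.map (coordEquiv hp)

theorem coordEquiv_apply (hp : p ∈ (extChartAt (𝓡 n) c).source) (u : EuclideanSpace ℝ (Fin n)) :
    coordEquiv hp u = coordField (𝓡 n) c u p := rfl

theorem coe_coordBasis (hp : p ∈ (extChartAt (𝓡 n) c).source) :
    ⇑(coordBasis hp) = fun i => coordField (𝓡 n) c (EuclideanSpace.single i 1) p := by
  ext1 i
  rw [coordBasis, Module.Basis.map_apply, OrthonormalBasis.coe_toBasis,
    EuclideanSpace.basisFun_apply, coordEquiv_apply]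

theorem trace_constr_mlieBracket_coordField {W : ∀ p : M, TangentSpace (𝓡 n) p}
    (hp : p ∈ (extChartAt (𝓡 n) c).source)
    (hW : MDifferentiableAt (𝓡 n) (𝓡 n).tangent (T% W) p) :
    LinearMap.trace ℝ _ ((coordBasis hp).constr ℝ fun i =>
        mlieBracket (𝓡 n) W (coordField (𝓡 n) c (EuclideanSpace.single i 1)) p) =
      -LinearMap.trace ℝ _ (fderiv ℝ (coordRep (𝓡 n) c W) (extChartAt (𝓡 n) c p)).toLinearMap := by
  rw [← map_neg, ← LinearMap.trace_conj' _ (coordEquiv hp)]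
  congr 1
  refine (coordBasis hp).ext fun i => ?_
  rw [(coordBasis hp).constr_basis, mlieBracket_swap_apply, mlieBracket_coordField hp hW,
    coe_coordBasis]
  simp only [← coordEquiv_apply hp]
  rw [LinearEquiv.conj_apply_apply, LinearEquiv.symm_apply_apply, LinearMap.neg_apply, map_neg]
  rfl

variable [RiemannianBundle (fun x : M => TangentSpace (𝓡 n) x)]

variable (n) in
/-- The density of the Riemannian volume at `p` with respect to Lebesgue measure in the chart
around `c`. -/
def volDensity (c p : M) : ℝ :=
  gramVolume fun i : Fin n => coordField (𝓡 n) c (EuclideanSpace.single i (1 : ℝ)) p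

theorem volDensity_eq_gramVolume (hp : p ∈ (extChartAt (𝓡 n) c).source) :
    volDensity n c p = gramVolume (coordBasis hp) := by
  rw [volDensity, coe_coordBasis]

theorem volDensity_pos (hp : p ∈ (extChartAt (𝓡 n) c).source) : 0 < volDensity n c p := by
  rw [volDensity_eq_gramVolume hp]
  exact gramVolume_pos (coordBasis hp).linearIndependent

theorem abs_volForm_coordFrame (o : ManifoldOrientation n M)
    (hy : y ∈ (extChartAt (𝓡 n) c).target) :
    |volForm o ((extChartAt (𝓡 n) c).symm y) (coordFrame c y)| =
      volDensity n c ((extChartAt (𝓡 n) c).symm y) := by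
  rw [abs_volForm, volDensity]
  exact congrArg gramVolume (funext fun i => (coordField_symm hy _).symm)

theorem volDensity_eq_abs_det_mul (hc : p ∈ (extChartAt (𝓡 n) c).source)
    (hd : p ∈ (extChartAt (𝓡 n) d).source) :
    volDensity n c p = |(fderiv ℝ (extChartAt (𝓡 n) d ∘ (extChartAt (𝓡 n) c).symm)
      (extChartAt (𝓡 n) c p)).det| * volDensity n d p := by
  set T := fderiv ℝ (extChartAt (𝓡 n) d ∘ (extChartAt (𝓡 n) c).symm) (extChartAt (𝓡 n) c p) with hT
  have hchange (u : EuclideanSpace ℝ (Fin n)) :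
      coordField (𝓡 n) c u p = coordField (𝓡 n) d (T u) p := by
    have hm := mdifferentiableAt_extChartAt (I := 𝓡 n) (x := d) (y := p) (by simpa using hd)
    rw [hT, ← mvfderiv_coordField hc hm u]
    conv_lhs => rw [← coordField_coordComp hd (coordField (𝓡 n) c u p), coordComp_eq_mfderiv hd]
    rfl
  have hcomp := gramVolume_comp_linearMap (orthoFrame (n := n) p)
    (EuclideanSpace.basisFun (Fin n) ℝ).toBasis (coordEquiv hd).toLinearMap T.toLinearMap
  simp only [OrthonormalBasis.coe_toBasis, Function.comp_def, EuclideanSpace.basisFun_apply,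
    LinearEquiv.coe_coe, coordEquiv_apply, ContinuousLinearMap.coe_coe, ← hchange] at hcomp
  exact hcomp

variable (n) in
/-- The components of the vector density `√(det g) W` in the chart around `c`, whose Euclidean
divergence is the Riemannian divergence of `W` times the volume density. -/
def coordFlux (c : M) (W : ∀ p : M, TangentSpace (𝓡 n) p) (y : EuclideanSpace ℝ (Fin n)) :
    EuclideanSpace ℝ (Fin n) :=
  volDensity n c ((extChartAt (𝓡 n) c).symm y) • coordRep (𝓡 n) c W y

variable [IsContMDiffRiemannianBundle (𝓡 n) ∞ (EuclideanSpace ℝ (Fin n))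
    (fun x : M => TangentSpace (𝓡 n) x)] {W : ∀ p : M, TangentSpace (𝓡 n) p}

theorem contDiffAt_volDensity (hy : y ∈ (extChartAt (𝓡 n) c).target) :
    ContDiffAt ℝ ∞ (volDensity n c ∘ (extChartAt (𝓡 n) c).symm) y := by
  have hp := (extChartAt (𝓡 n) c).map_target hy
  have hsmooth : ContMDiffAt (𝓡 n) 𝓘(ℝ) ∞ (fun q => (Matrix.gram ℝ fun i : Fin n =>
      coordField (𝓡 n) c (EuclideanSpace.single i (1 : ℝ)) q).det)
      ((extChartAt (𝓡 n) c).symm y) := by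
    simp only [Matrix.det_apply', Matrix.gram_apply]
    exact ContMDiffAt.sum fun σ _ => contMDiffAt_const.mul <| contMDiffAt_finsetProd fun i _ =>
      ContMDiffAt.inner_bundle (IB := 𝓡 n) (F := EuclideanSpace ℝ (Fin n))
        (E := fun x : M => TangentSpace (𝓡 n) x)
        (contMDiffAt_coordField hp _) (contMDiffAt_coordField hp _)
  exact ContDiffAt.sqrt (contMDiffAt_iff_contDiffAt.1 <|
    hsmooth.comp y (contMDiffAt_extChartAt_symm hy)) (Real.sqrt_pos.1 (volDensity_pos hp)).ne'

theorem contDiffAt_coordFlux {k : ℕ∞} (hy : y ∈ (extChartAt (𝓡 n) c).target)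
    (hW : ContMDiffAt (𝓡 n) (𝓡 n).tangent k (T% W) ((extChartAt (𝓡 n) c).symm y)) :
    ContDiffAt ℝ k (coordFlux n c W) y :=
  ((contDiffAt_volDensity hy).of_le (by exact_mod_cast le_top)).smul (contDiffAt_coordRep hy hW)

theorem mvfderiv_volDensity (o : ManifoldOrientation n M) (hp : p ∈ (extChartAt (𝓡 n) c).source)
    (hW : MDifferentiableAt (𝓡 n) (𝓡 n).tangent (T% W) p) :
    mvfderiv (𝓡 n) (volDensity n c) p (W p) = (divergence o W p - LinearMap.trace ℝ _
      (fderiv ℝ (coordRep (𝓡 n) c W) (extChartAt (𝓡 n) c p)).toLinearMap) * volDensity n c p := by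
  have hV (i : Fin n) : MDifferentiableAt (𝓡 n) (𝓡 n).tangent
      (T% (coordField (𝓡 n) c (EuclideanSpace.single i (1 : ℝ)))) p :=
    mdifferentiableAt_coordField hp _
  have hderiv := mvfderiv_gramVolume hV (coe_coordBasis hp) (W p)
  rw [trace_constr_nabla hW hV (coe_coordBasis hp), trace_constr_mlieBracket_coordField hp hW,
    ← divergence_eq_trace_nabla o hW, ← sub_eq_add_neg, ← volDensity_eq_gramVolume] at hderiv
  exact hderiv

theorem divergence_mul_volDensity (o : ManifoldOrientation n M)
    (hy : y ∈ (extChartAt (𝓡 n) c).target)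
    (hW : ContMDiffAt (𝓡 n) (𝓡 n).tangent 1 (T% W) ((extChartAt (𝓡 n) c).symm y)) :
    divergence o W ((extChartAt (𝓡 n) c).symm y) * volDensity n c ((extChartAt (𝓡 n) c).symm y) =
      LinearMap.trace ℝ _ (fderiv ℝ (coordFlux n c W) y).toLinearMap := by
  have hp := (extChartAt (𝓡 n) c).map_target hy
  have hW' := hW.mdifferentiableAt one_ne_zero
  have hdensity := (contDiffAt_volDensity (n := n) hy).differentiableAt (by simp)
  have hrep := (contDiffAt_coordRep (k := 1) hy hW).differentiableAt one_ne_zero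
  have hderiv := mvfderiv_volDensity o hp hW'
  rw [mvfderiv_eq_fderiv_coordComp hp, (extChartAt (𝓡 n) c).right_inv hy] at hderiv
  · refine Eq.trans ?_ (trace_fderiv_smul hdensity hrep).symm
    rw [coordRep, hderiv, Function.comp_apply]
    ring
  · exact mdifferentiableAt_of_comp_symm hp (by rwa [(extChartAt (𝓡 n) c).right_inv hy])

end Density

section EuclideanDivergence

variable {E : Type*} [NormedAddCommGroup E] [NormedSpace ℝ E]

theorem contDiff_indicator_of_forall_eq_zero {F : Type*} [NormedAddCommGroup F] [NormedSpace ℝ F]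
    {k : WithTop ℕ∞} {g : E → F} {U K : Set E} (hU : IsOpen U) (hK : IsClosed K) (hKU : K ⊆ U)
    (hg : ∀ y ∈ U, ContDiffAt ℝ k g y) (h0 : ∀ y ∈ U, y ∉ K → g y = 0) :
    ContDiff ℝ k (U.indicator g) := by
  refine contDiff_iff_contDiffAt.2 fun y => ?_
  by_cases hy : y ∈ K
  · refine (hg y (hKU hy)).congr_of_eventuallyEq ?_
    filter_upwards [hU.mem_nhds (hKU hy)] with z hz using Set.indicator_of_mem hz g
  · refine (contDiffAt_const (c := (0 : F))).congr_of_eventuallyEq ?_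
    filter_upwards [hK.isOpen_compl.mem_nhds hy] with z hz
    exact Set.indicator_apply_eq_zero.2 fun hzU => h0 z hzU hz

variable [FiniteDimensional ℝ E] [MeasurableSpace E] [BorelSpace E] {μ : Measure E}
  [μ.IsAddHaarMeasure] {g : E → E}

theorem integral_fderiv_apply_eq_zero (hg : ContDiff ℝ 1 g) (hc : HasCompactSupport g) (v : E) :
    ∫ y, fderiv ℝ g y v ∂μ = 0 := by
  have hderiv : Integrable (fun y => fderiv ℝ g y v) μ :=
    ((hg.continuous_fderiv one_ne_zero).clm_apply continuous_const).integrable_of_hasCompactSupport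
      (hc.fderiv_apply ℝ v)
  have hint : Integrable g μ := hg.continuous.integrable_of_hasCompactSupport hc
  simpa using integral_smul_fderiv_eq_neg_fderiv_smul_of_integrable (μ := μ)
    (f := fun _ : E => (1 : ℝ)) (g := g) (v := v) (by simp) (by simpa using hderiv)
    (by simpa using hint) (by fun_prop) fun x _ => hg.differentiable one_ne_zero x

theorem integral_trace_fderiv_eq_zero (hg : ContDiff ℝ 1 g) (hc : HasCompactSupport g) :
    ∫ y, LinearMap.trace ℝ E (fderiv ℝ g y).toLinearMap ∂μ = 0 := by
  let b := Module.finBasis ℝ E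
  have hint (i) : Integrable (fun y => fderiv ℝ g y (b i)) μ :=
    ((hg.continuous_fderiv one_ne_zero).clm_apply continuous_const).integrable_of_hasCompactSupport
      (hc.fderiv_apply ℝ (b i))
  have hcoord (i) : ∫ y, (b.coord i).toContinuousLinearMap (fderiv ℝ g y (b i)) ∂μ = 0 := by
    rw [ContinuousLinearMap.integral_comp_comm _ (hint i), integral_fderiv_apply_eq_zero hg hc,
      map_zero]
  have htrace (y) : LinearMap.trace ℝ E (fderiv ℝ g y).toLinearMap =
      ∑ i, (b.coord i).toContinuousLinearMap (fderiv ℝ g y (b i)) := by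
    simp only [LinearMap.trace_eq_matrix_trace ℝ b, Matrix.trace, Matrix.diag_apply,
      LinearMap.toMatrix_apply]
    rfl
  simp only [htrace]
  rw [integral_finsetSum _ fun i _ => (b.coord i).toContinuousLinearMap.integrable_comp (hint i)]
  exact Finset.sum_eq_zero fun i _ => hcoord i

theorem setIntegral_trace_fderiv_eq_zero {U K : Set E} (hU : IsOpen U) (hK : IsCompact K)
    (hKU : K ⊆ U) (hg : ∀ y ∈ U, ContDiffAt ℝ 1 g y) (h0 : ∀ y ∈ U, y ∉ K → g y = 0) :
    ∫ y in U, LinearMap.trace ℝ E (fderiv ℝ g y).toLinearMap ∂μ = 0 := by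
  have hzero (y) (hy : y ∉ K) : U.indicator g y = 0 :=
    Set.indicator_apply_eq_zero.2 fun hyU => h0 y hyU hy
  have hderiv : Set.EqOn (fun y => LinearMap.trace ℝ E (fderiv ℝ g y).toLinearMap)
      (fun y => LinearMap.trace ℝ E (fderiv ℝ (U.indicator g) y).toLinearMap) U := fun y hy => by
    have hev : U.indicator g =ᶠ[𝓝 y] g := by
      filter_upwards [hU.mem_nhds hy] with z hz using Set.indicator_of_mem hz g
    simp only [hev.fderiv_eq]
  rw [setIntegral_congr_fun hU.measurableSet hderiv,
    setIntegral_eq_integral_of_forall_compl_eq_zero]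
  · exact integral_trace_fderiv_eq_zero
      (contDiff_indicator_of_forall_eq_zero hU hK.isClosed hKU hg h0) (.intro hK hzero)
  · intro y hy
    have hev : U.indicator g =ᶠ[𝓝 y] fun _ => 0 := by
      filter_upwards [hK.isClosed.isOpen_compl.mem_nhds fun h => hy (hKU h)] with z hz
      exact hzero z hz
    rw [hev.fderiv_eq, fderiv_const_apply]
    exact map_zero _

end EuclideanDivergence

section ChartIntegral

variable {n : ℕ} {M : Type*} [TopologicalSpace M] [ChartedSpace (EuclideanSpace ℝ (Fin n)) M]
  [IsManifold (𝓡 n) ∞ M] [RiemannianBundle (fun x : M => TangentSpace (𝓡 n) x)] {c d : M}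

variable (n) in
/-- The integral of a function over the domain of the chart around `c`, against the Riemannian
volume. -/
def chartIntegral (c : M) (h : M → ℝ) : ℝ :=
  ∫ y in (extChartAt (𝓡 n) c).target, h ((extChartAt (𝓡 n) c).symm y) *
    volDensity n c ((extChartAt (𝓡 n) c).symm y)

theorem chartIntegral_eq_setIntegral_inter {h : M → ℝ}
    (hd : ∀ p, h p ≠ 0 → p ∈ (extChartAt (𝓡 n) d).source) :
    chartIntegral n c h = ∫ y in ((extChartAt (𝓡 n) c).symm.trans (extChartAt (𝓡 n) d)).source,
      h ((extChartAt (𝓡 n) c).symm y) * volDensity n c ((extChartAt (𝓡 n) c).symm y) := by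
  refine setIntegral_eq_of_subset_of_forall_sdiff_eq_zero
    (isOpen_extChartAt_target c).measurableSet Set.inter_subset_left fun y hy => ?_
  refine mul_eq_zero_of_left (by_contra fun hne => hy.2 ⟨hy.1, hd _ hne⟩) _

theorem chartIntegral_eq_chartIntegral {h : M → ℝ}
    (hc : ∀ p, h p ≠ 0 → p ∈ (extChartAt (𝓡 n) c).source)
    (hd : ∀ p, h p ≠ 0 → p ∈ (extChartAt (𝓡 n) d).source) :
    chartIntegral n c h = chartIntegral n d h := by
  set φ := (extChartAt (𝓡 n) c).symm.trans (extChartAt (𝓡 n) d)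
  have hopen : IsOpen φ.source := (continuousOn_extChartAt_symm c).isOpen_inter_preimage
    (isOpen_extChartAt_target c) (isOpen_extChartAt_source d)
  have hmem {y} (hy : y ∈ φ.source) := (extChartAt (𝓡 n) c).map_target hy.1
  have hderiv : ∀ y ∈ φ.source, HasFDerivWithinAt φ (fderiv ℝ φ y) φ.source y := fun y hy => by
    have hm := mdifferentiableAt_extChartAt (I := 𝓡 n) (x := d) (y := (extChartAt (𝓡 n) c).symm y)
      (by simpa using hy.2)
    have hdiff := differentiableAt_comp_symm (hmem hy) hm
    rw [(extChartAt (𝓡 n) c).right_inv hy.1] at hdiff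
    exact hdiff.hasFDerivAt.hasFDerivWithinAt
  have hsource : ((extChartAt (𝓡 n) d).symm.trans (extChartAt (𝓡 n) c)).source = φ '' φ.source :=
    φ.image_source_eq_target.symm
  rw [chartIntegral_eq_setIntegral_inter hd, chartIntegral_eq_setIntegral_inter hc, hsource,
    integral_image_eq_integral_abs_det_fderiv_smul _ hopen.measurableSet hderiv φ.injOn]
  refine setIntegral_congr_fun hopen.measurableSet fun y hy => ?_
  have hinv : (extChartAt (𝓡 n) d).symm (φ y) = (extChartAt (𝓡 n) c).symm y :=
    (extChartAt (𝓡 n) d).left_inv hy.2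
  simp only [hinv, smul_eq_mul]
  rw [volDensity_eq_abs_det_mul (hmem hy) hy.2, (extChartAt (𝓡 n) c).right_inv hy.1]
  change h _ * (|(fderiv ℝ φ y).det| * _) = _
  ring

variable [IsContMDiffRiemannianBundle (𝓡 n) ∞ (EuclideanSpace ℝ (Fin n))
    (fun x : M => TangentSpace (𝓡 n) x)]

theorem integrableOn_mul_volDensity {h : M → ℝ} (hh : Continuous h) {T : Set M} (hT : IsCompact T)
    (hTc : T ⊆ (extChartAt (𝓡 n) c).source) (h0 : ∀ p ∉ T, h p = 0) :
    IntegrableOn (fun y => h ((extChartAt (𝓡 n) c).symm y) *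
      volDensity n c ((extChartAt (𝓡 n) c).symm y)) (extChartAt (𝓡 n) c).target := by
  have hcont : ContinuousOn (fun y => h ((extChartAt (𝓡 n) c).symm y) *
      volDensity n c ((extChartAt (𝓡 n) c).symm y)) (extChartAt (𝓡 n) c).target :=
    (hh.comp_continuousOn (continuousOn_extChartAt_symm c)).mul fun y hy =>
      (contDiffAt_volDensity hy).continuousAt.continuousWithinAt
  have hK : IsCompact (extChartAt (𝓡 n) c '' T) :=
    hT.image_of_continuousOn ((continuousOn_extChartAt c).mono hTc)
  refine IntegrableOn.of_forall_sdiff_eq_zero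
    ((hcont.mono ((extChartAt (𝓡 n) c).mapsTo.mono_left hTc).image_subset).integrableOn_compact hK)
    (isOpen_extChartAt_target c).measurableSet fun y hy => mul_eq_zero_of_left (h0 _ ?_) _
  exact fun hyT => hy.2 ⟨_, hyT, (extChartAt (𝓡 n) c).right_inv hy.1⟩

theorem chartIntegral_sum {ι : Type*} (S : Finset ι) {h : ι → M → ℝ}
    (hh : ∀ i ∈ S, Continuous (h i)) {T : Set M} (hT : IsCompact T)
    (hTc : T ⊆ (extChartAt (𝓡 n) c).source) (h0 : ∀ i ∈ S, ∀ p ∉ T, h i p = 0) :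
    chartIntegral n c (fun p => ∑ i ∈ S, h i p) = ∑ i ∈ S, chartIntegral n c (h i) := by
  simp only [chartIntegral, Finset.sum_mul]
  exact integral_finsetSum _ fun i hi => integrableOn_mul_volDensity (hh i hi) hT hTc (h0 i hi)

variable {W : ∀ p : M, TangentSpace (𝓡 n) p}

theorem chartIntegral_divergence_eq_zero (o : ManifoldOrientation n M)
    (hW : ContMDiff (𝓡 n) (𝓡 n).tangent 1 (T% W)) {T : Set M} (hT : IsCompact T)
    (hTc : T ⊆ (extChartAt (𝓡 n) c).source) (h0 : ∀ p ∉ T, W p = 0) :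
    chartIntegral n c (divergence o W) = 0 := by
  rw [chartIntegral, setIntegral_congr_fun (isOpen_extChartAt_target c).measurableSet
    fun y hy => divergence_mul_volDensity o hy (hW _)]
  refine setIntegral_trace_fderiv_eq_zero (isOpen_extChartAt_target c)
    (hT.image_of_continuousOn ((continuousOn_extChartAt c).mono hTc))
    ((extChartAt (𝓡 n) c).mapsTo.mono_left hTc).image_subset
    (fun y hy => contDiffAt_coordFlux (k := 1) hy (hW _)) fun y hy hyT => ?_
  rw [coordFlux, coordRep, h0 _ fun h => hyT ⟨_, h, (extChartAt (𝓡 n) c).right_inv hy⟩, map_zero,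
    smul_zero]

theorem continuous_divergence (o : ManifoldOrientation n M)
    (hW : ContMDiff (𝓡 n) (𝓡 n).tangent 1 (T% W)) : Continuous (divergence o W) := by
  refine continuous_iff_continuousAt.2 fun p => ?_
  have hy := mem_extChartAt_target (I := 𝓡 n) p
  have hpos {y} (hy : y ∈ (extChartAt (𝓡 n) p).target) :=
    (volDensity_pos ((extChartAt (𝓡 n) p).map_target hy)).ne'
  have hquot : ContinuousAt (fun y => LinearMap.trace ℝ _ (fderiv ℝ (coordFlux n p W) y).toLinearMap
      / volDensity n p ((extChartAt (𝓡 n) p).symm y)) (extChartAt (𝓡 n) p p) := by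
    refine ContinuousAt.div ?_ (contDiffAt_volDensity hy).continuousAt (hpos hy)
    exact (LinearMap.continuous_of_finiteDimensional ((LinearMap.trace ℝ _).comp
      (ContinuousLinearMap.coeLM ℝ))).continuousAt.comp
        ((contDiffAt_coordFlux (k := 1) hy (hW _)).fderiv_right (m := 0) le_rfl).continuousAt
  refine (hquot.comp (f := extChartAt (𝓡 n) p) (continuousAt_extChartAt p)).congr ?_
  filter_upwards [extChartAt_source_mem_nhds (I := 𝓡 n) p] with q hq
  have hqy := (extChartAt (𝓡 n) p).map_source hq
  rw [Function.comp_apply, ← divergence_mul_volDensity o hqy (hW _),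
    mul_div_cancel_right₀ _ (hpos hqy), (extChartAt (𝓡 n) p).left_inv hq]

end ChartIntegral

section DivergenceAlgebra

variable {n : ℕ} {M : Type*} [TopologicalSpace M] [ChartedSpace (EuclideanSpace ℝ (Fin n)) M]
  [IsManifold (𝓡 n) ∞ M] [RiemannianBundle (fun x : M => TangentSpace (𝓡 n) x)]
  [IsContMDiffRiemannianBundle (𝓡 n) ∞ (EuclideanSpace ℝ (Fin n))
    (fun x : M => TangentSpace (𝓡 n) x)]
  (o : ManifoldOrientation n M) {x : M}

theorem divergence_fun_sum {ι : Type*} (S : Finset ι) {W : ι → ∀ p : M, TangentSpace (𝓡 n) p}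
    (hW : ∀ i, MDifferentiableAt (𝓡 n) (𝓡 n).tangent (T% (W i)) x) :
    divergence o (fun p => ∑ i ∈ S, W i p) x = ∑ i ∈ S, divergence o (W i) x := by
  have hnabla : nabla (𝓡 n) (fun p => ∑ i ∈ S, W i p) x = ∑ i ∈ S, nabla (𝓡 n) (W i) x := by
    classical
    induction S using Finset.induction_on with
    | empty => exact congrFun (leviCivita (𝓡 n) M).zero x
    | insert i S hi ih =>
      rw [Finset.sum_insert hi, ← ih]
      simp only [Finset.sum_insert hi]
      exact (leviCivita (𝓡 n) M).isCovariantDerivativeOnUniv.add (hW i)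
        (.sum_section fun j _ => hW j)
  rw [divergence_eq_trace_nabla o (.sum_section fun i _ => hW i), hnabla,
    ContinuousLinearMap.toLinearMap_sum, map_sum]
  exact Finset.sum_congr rfl fun i _ => (divergence_eq_trace_nabla o (hW i)).symm

theorem divergence_fun_smul {f : M → ℝ} {W : ∀ p : M, TangentSpace (𝓡 n) p}
    (hf : MDifferentiableAt (𝓡 n) 𝓘(ℝ, ℝ) f x)
    (hW : MDifferentiableAt (𝓡 n) (𝓡 n).tangent (T% W) x) :
    divergence o (fun p => f p • W p) x =
      f x * divergence o W x + mvfderiv (𝓡 n) f x (W x) := by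
  have hnabla : (nabla (𝓡 n) (fun p => f p • W p) x).toLinearMap =
      f x • (nabla (𝓡 n) W x).toLinearMap +
        (mvfderiv (𝓡 n) f x).toLinearMap.smulRight (W x) :=
    congrArg ContinuousLinearMap.toLinearMap
      ((leviCivita (𝓡 n) M).isCovariantDerivativeOnUniv.leibniz hW hf)
  refine (divergence_eq_trace_nabla o (hf.smul_section hW)).trans ?_
  refine (congrArg (LinearMap.trace ℝ _) hnabla).trans ?_
  rw [map_add, map_smul, LinearMap.trace_smulRight, smul_eq_mul, divergence_eq_trace_nabla o hW]
  rfl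

theorem divergence_fun_smul_eq_zero_of_notMem_tsupport {f : M → ℝ}
    {W : ∀ p : M, TangentSpace (𝓡 n) p}
    (hW : MDifferentiableAt (𝓡 n) (𝓡 n).tangent (T% W) x) (hx : x ∉ tsupport f) :
    divergence o (fun p => f p • W p) x = 0 := by
  have hf : f =ᶠ[𝓝 x] fun _ => 0 := notMem_tsupport_iff_eventuallyEq.1 hx
  rw [divergence_fun_smul o (mdifferentiableAt_const.congr_of_eventuallyEq hf) hW,
    mvfderiv_congr_of_eventuallyEq hf,
    Filter.EventuallyEq.eq_of_nhds hf, zero_mul, zero_add, mvfderiv_const]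
  rfl

theorem symDivTensor_apply_self {X Y : ∀ p : M, TangentSpace (𝓡 n) p}
    (hX : MDifferentiableAt (𝓡 n) (𝓡 n).tangent (T% X) x)
    (hY : MDifferentiableAt (𝓡 n) (𝓡 n).tangent (T% Y) x) :
    symDivTensor o Y x (X x) (X x) =
      2 * inner ℝ (X x) (mlieBracket (𝓡 n) X Y x) +
        divergence o (fun p => (inner ℝ (X p) (X p) : ℝ) • Y p) x := by
  have happly : symDivTensor o Y x (X x) (X x) = nablaFormSym (𝓡 n) (flat (𝓡 n) Y) x (X x) (X x) +
    divergence o Y x * inner ℝ (X x) (X x) := rfl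
  rw [happly, nablaFormSym_flat_apply hY, divergence_fun_smul o (mdiffAt_inner hX hX) hY,
    mvfderiv_inner hX hX, mlieBracket_eq_nabla_sub_nabla hX hY, inner_sub_right,
    real_inner_comm (X x) (nabla _ _ x _), real_inner_comm (X x) (nabla _ _ x _)]
  ring

end DivergenceAlgebra

section DivergenceTheorem

variable {n : ℕ} {M : Type*} [TopologicalSpace M] [ChartedSpace (EuclideanSpace ℝ (Fin n)) M]
  [IsManifold (𝓡 n) ∞ M] [CompactSpace M] [T2Space M]

theorem tsupport_chartPartition_subset (c : M) :
    tsupport (chartPartition n M c) ⊆ (extChartAt (𝓡 n) c).source := by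
  rw [extChartAt_source]
  exact (SmoothPartitionOfUnity.exists_isSubordinate_chartAt_source (𝓡 n) M).choose_spec c

theorem chartPartition_mul_eq_zero {c p : M} (hp : p ∉ tsupport (chartPartition n M c)) (r : ℝ) :
    chartPartition n M c p * r = 0 :=
  mul_eq_zero_of_left (image_eq_zero_of_notMem_tsupport hp) r

theorem continuous_chartPartition_mul (c : M) {f : M → ℝ} (hf : Continuous f) :
    Continuous fun p => chartPartition n M c p * f p :=
  (chartPartition n M c).contMDiff.continuous.mul hf

theorem exists_finset_chartPartition : ∃ S : Finset M,
    (∀ c ∉ S, ∀ p, chartPartition n M c p = 0) ∧ ∀ p, ∑ c ∈ S, chartPartition n M c p = 1 := by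
  have hfin := (chartPartition n M).locallyFinite.finite_nonempty_of_compact
  have h0 (c) (hc : c ∉ hfin.toFinset) (p) : chartPartition n M c p = 0 :=
    by_contra fun h => hc (hfin.mem_toFinset.2 ⟨p, h⟩)
  refine ⟨hfin.toFinset, h0, fun p => ?_⟩
  rw [← (chartPartition n M).sum_eq_one (Set.mem_univ p)]
  exact (finsum_eq_sum_of_support_subset _ fun c hc => by_contra fun h => hc (h0 c h p)).symm

variable [RiemannianBundle (fun x : M => TangentSpace (𝓡 n) x)] (o : ManifoldOrientation n M)

theorem integralVol_eq_sum {S : Finset M} (hS : ∀ c ∉ S, ∀ p, chartPartition n M c p = 0)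
    (f : M → ℝ) :
    integralVol o f = ∑ c ∈ S, chartIntegral n c (fun p => chartPartition n M c p * f p) := by
  have hfinsum : integralVol o f =
      ∑ᶠ c : M, chartIntegral n c (fun p => chartPartition n M c p * f p) := by
    refine finsum_congr fun c => setIntegral_congr_fun
      (isOpen_extChartAt_target c).measurableSet fun y hy => ?_
    have hsign : Real.sign (volForm o ((extChartAt (𝓡 n) c).symm y) (coordFrame c y)) *
        volForm o ((extChartAt (𝓡 n) c).symm y) (coordFrame c y) =
          volDensity n c ((extChartAt (𝓡 n) c).symm y) := by
      rw [← abs_volForm_coordFrame o hy, sign_mul_self_eq_abs]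
    simp only [AlternatingMap.smul_apply, smul_eq_mul]
    rw [← hsign]
    ring
  rw [hfinsum]
  refine finsum_eq_sum_of_support_subset _ fun c hc => by_contra fun h => hc ?_
  simp only [chartIntegral, hS c h, zero_mul, integral_zero]

theorem integralVol_const_mul (r : ℝ) (f : M → ℝ) :
    integralVol o (fun p => r * f p) = r * integralVol o f := by
  obtain ⟨S, hS, -⟩ := exists_finset_chartPartition (n := n) (M := M)
  simp only [integralVol_eq_sum o hS, Finset.mul_sum, chartIntegral, ← integral_const_mul]
  refine Finset.sum_congr rfl fun c _ => integral_congr_ae (.of_forall fun y => ?_)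
  ring

variable [IsContMDiffRiemannianBundle (𝓡 n) ∞ (EuclideanSpace ℝ (Fin n))
    (fun x : M => TangentSpace (𝓡 n) x)]

theorem integralVol_sum {ι : Type*} (S : Finset ι) {f : ι → M → ℝ} (hf : ∀ i, Continuous (f i)) :
    integralVol o (fun p => ∑ i ∈ S, f i p) = ∑ i ∈ S, integralVol o (f i) := by
  obtain ⟨C, hC, -⟩ := exists_finset_chartPartition (n := n) (M := M)
  simp only [integralVol_eq_sum o hC, Finset.mul_sum]
  rw [Finset.sum_comm]
  exact Finset.sum_congr rfl fun c _ => chartIntegral_sum S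
    (fun i _ => continuous_chartPartition_mul c (hf i)) (isClosed_tsupport _).isCompact
    (tsupport_chartPartition_subset c) fun i _ p hp => chartPartition_mul_eq_zero hp _

theorem integralVol_add {f g : M → ℝ} (hf : Continuous f) (hg : Continuous g) :
    integralVol o (fun p => f p + g p) = integralVol o f + integralVol o g := by
  simpa using integralVol_sum o Finset.univ (f := ![f, g]) (Fin.forall_fin_two.2 ⟨hf, hg⟩)

theorem integralVol_eq_chartIntegral {h : M → ℝ} (hh : Continuous h) {T : Set M} (hT : IsClosed T)
    {d : M} (hTd : T ⊆ (extChartAt (𝓡 n) d).source) (h0 : ∀ p ∉ T, h p = 0) :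
    integralVol o h = chartIntegral n d h := by
  obtain ⟨S, hS, hS1⟩ := exists_finset_chartPartition (n := n) (M := M)
  have hchange (c : M) : chartIntegral n c (fun p => chartPartition n M c p * h p) =
      chartIntegral n d (fun p => chartPartition n M c p * h p) :=
    chartIntegral_eq_chartIntegral
      (fun p hp => tsupport_chartPartition_subset c (subset_tsupport _ (left_ne_zero_of_mul hp)))
      fun p hp => hTd (by_contra fun hpT => right_ne_zero_of_mul hp (h0 p hpT))
  simp only [integralVol_eq_sum o hS, hchange]
  rw [← chartIntegral_sum S (fun c _ => continuous_chartPartition_mul c hh) hT.isCompact hTd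
    fun c _ p hp => mul_eq_zero_of_right _ (h0 p hp)]
  simp only [← Finset.sum_mul, hS1, one_mul]

theorem integralVol_divergence {W : ∀ p : M, TangentSpace (𝓡 n) p}
    (hW : ContMDiff (𝓡 n) (𝓡 n).tangent 1 (T% W)) : integralVol o (divergence o W) = 0 := by
  obtain ⟨S, -, hS⟩ := exists_finset_chartPartition (n := n) (M := M)
  have hmul (c : M) : ContMDiff (𝓡 n) (𝓡 n).tangent 1 (T% fun p => chartPartition n M c p • W p) :=
    ((chartPartition n M c).contMDiff.of_le (mod_cast le_top)).smul_section hW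
  have hpieces : divergence o W =
      fun p => ∑ c ∈ S, divergence o (fun q => chartPartition n M c q • W q) p := by
    ext p
    rw [← divergence_fun_sum o S fun c => (hmul c).mdifferentiable one_ne_zero p]
    simp only [← Finset.sum_smul, hS, one_smul]
  rw [hpieces, integralVol_sum o S fun c => continuous_divergence o (hmul c)]
  refine Finset.sum_eq_zero fun c _ => ?_
  rw [integralVol_eq_chartIntegral o (continuous_divergence o (hmul c)) (isClosed_tsupport _)
    (tsupport_chartPartition_subset c) fun p hp => divergence_fun_smul_eq_zero_of_notMem_tsupport o
      (hW.mdifferentiable one_ne_zero p) hp]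
  refine chartIntegral_divergence_eq_zero o (hmul c) (isClosed_tsupport _).isCompact
    (tsupport_chartPartition_subset c) fun p hp => ?_
  rw [image_eq_zero_of_notMem_tsupport hp, zero_smul]

theorem integralVol_symDivTensor_apply_self {X Y : ∀ p : M, TangentSpace (𝓡 n) p}
    (hX : ContMDiff (𝓡 n) (𝓡 n).tangent 1 (T% X)) (hY : ContMDiff (𝓡 n) (𝓡 n).tangent 1 (T% Y)) :
    integralVol o (fun x => symDivTensor o Y x (X x) (X x)) =
      2 * l2Inner o X (mlieBracket (𝓡 n) X Y) := by
  have : IsManifold (𝓡 n) (minSmoothness ℝ 2) M := by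
    rw [minSmoothness_of_isRCLikeNormedField]
    infer_instance
  have : IsManifold (𝓡 n) ((1 : ℕ∞) + 1) M := .of_le (n := ∞) (mod_cast le_top)
  have hbracket : ContMDiff (𝓡 n) (𝓡 n).tangent 0 (T% (mlieBracket (𝓡 n) X Y)) :=
    ContDiff.mlieBracket_vectorField (m := 0) (n := 1) hX hY (by simp)
  have hcont : Continuous fun x => (2 : ℝ) * inner ℝ (X x) (mlieBracket (𝓡 n) X Y x) :=
    continuous_const.mul
      (contMDiff_inner (k := 0) (hX.of_le (mod_cast zero_le_one)) hbracket).continuous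
  have hdiv : ContMDiff (𝓡 n) (𝓡 n).tangent 1 (T% fun p => (inner ℝ (X p) (X p) : ℝ) • Y p) :=
    (contMDiff_inner (k := 1) hX hX).smul_section hY
  simp only [fun x => symDivTensor_apply_self o (hX.mdifferentiable one_ne_zero x)
    (hY.mdifferentiable one_ne_zero x)]
  rw [integralVol_add o hcont (continuous_divergence o hdiv), integralVol_divergence o hdiv,
    add_zero, integralVol_const_mul]
  rfl

end DivergenceTheorem

section Superposition

universe u

variable {K : Type*} [TopologicalSpace K] [CompactSpace K] {E F : Type u}
  [NormedAddCommGroup E] [NormedSpace ℝ E] [NormedAddCommGroup F] [NormedSpace ℝ F]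

set_option synthInstance.maxHeartbeats 400000 in
-- the norm on `C(K, E →L[ℝ] F)` is found through a long chain of instances
variable (K E F) in
/-- Pointwise application of a continuous family of operators to a continuous map, as a bounded
bilinear map. -/
def pointwiseApply : C(K, E →L[ℝ] F) →L[ℝ] C(K, E) →L[ℝ] C(K, F) :=
  LinearMap.mkContinuous₂
    (LinearMap.mk₂ ℝ (fun (A : C(K, E →L[ℝ] F)) (η : C(K, E)) =>
        (⟨fun t => A t (η t), A.continuous.clm_apply η.continuous⟩ : C(K, F)))
      (fun _ _ _ => by ext; simp) (fun _ _ _ => by ext; simp) (fun _ _ _ => by ext; simp)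
      (fun _ _ _ => by ext; simp)) 1 fun A η => by
    rw [one_mul, ContinuousMap.norm_le _ (by positivity)]
    exact fun t => (A t).le_of_opNorm_le_of_le (A.norm_coe_le_norm t) (η.norm_coe_le_norm t)

theorem hasFDerivAt_postcomp {f : C(E, F)} {f' : C(E, E →L[ℝ] F)}
    (hf : ∀ x, HasFDerivAt f (f' x) x) (γ : C(K, E)) :
    HasFDerivAt (fun γ : C(K, E) => f.comp γ) (pointwiseApply K E F (f'.comp γ)) γ := by
  rw [hasFDerivAt_iff_isLittleO_nhds_zero, Asymptotics.isLittleO_iff]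
  intro ε hε
  obtain ⟨δ, hδ, hf'δ⟩ := Metric.mem_uniformity_dist.1
    ((isCompact_range γ.continuous).uniformContinuousAt_of_continuousAt f'
      (fun x _ => f'.continuous.continuousAt) (Metric.dist_mem_uniformity hε))
  filter_upwards [Metric.ball_mem_nhds (0 : C(K, E)) hδ] with η hη
  rw [mem_ball_zero_iff] at hη
  rw [ContinuousMap.norm_le _ (by positivity)]
  intro t
  have hηt : ‖η t‖ < δ := (η.norm_coe_le_norm t).trans_lt hη
  have hmean := (convex_ball (γ t) δ).norm_image_sub_le_of_norm_hasFDerivWithin_le' (f := f)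
    (f' := f') (φ := f' (γ t)) (C := ε) (x := γ t) (y := γ t + η t)
    (fun x _ => (hf x).hasFDerivWithinAt) (fun x hx => by
      rw [← dist_eq_norm, dist_comm]
      exact (hf'δ (Metric.mem_ball'.1 hx) ⟨t, rfl⟩).le)
    (Metric.mem_ball_self hδ) (by simpa using hηt)
  rw [add_sub_cancel_left] at hmean
  exact hmean.trans (mul_le_mul_of_nonneg_left (η.norm_coe_le_norm t) hε.le)

theorem contDiff_postcomp {f : C(E, F)} (hf : ContDiff ℝ ∞ f) :
    ContDiff ℝ ∞ (fun γ : C(K, E) => f.comp γ) := by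
  refine contDiff_infty.2 fun k => ?_
  induction k generalizing F with
  | zero => exact contDiff_zero.2 (ContinuousMap.continuous_postcomp f)
  | succ k ih =>
    rw [contDiff_infty_iff_fderiv] at hf
    let f' : C(E, E →L[ℝ] F) := ⟨fderiv ℝ f, hf.2.continuous⟩
    have happly : ContDiff ℝ k (pointwiseApply K E F) := ContinuousLinearMap.contDiff _
    exact contDiff_succ_iff_hasFDerivAt.2 ⟨fun γ => pointwiseApply K E F (f'.comp γ),
      happly.comp (ih (f := f') hf.2), hasFDerivAt_postcomp fun x => (hf.1 x).hasFDerivAt⟩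

end Superposition

section LocalFlow

variable {E : Type*} [NormedAddCommGroup E] [NormedSpace ℝ E] {r : ℝ}

variable (E) in
/-- The primitive vanishing at `0` of a curve on `[-r, r]`, as a bounded operator. -/
def primitiveCLM (hr : 0 ≤ r) : C(Set.Icc (-r) r, E) →L[ℝ] C(Set.Icc (-r) r, E) :=
  have hint (γ : C(Set.Icc (-r) r, E)) (a b : ℝ) :
      IntervalIntegrable (γ.IccExtend (neg_le_self hr)) volume a b :=
    (γ.IccExtend _).continuous.intervalIntegrable a b
  LinearMap.mkContinuous
    { toFun := fun γ => ⟨fun s => ∫ t in (0 : ℝ)..s, γ.IccExtend (neg_le_self hr) t,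
        (intervalIntegral.continuous_primitive (hint γ) 0).comp continuous_subtype_val⟩
      map_add' := fun γ η => by
        ext s
        exact intervalIntegral.integral_add (hint γ 0 s) (hint η 0 s)
      map_smul' := fun c γ => by
        ext s
        exact intervalIntegral.integral_smul c _ } r fun γ => by
    rw [ContinuousMap.norm_le _ (by positivity)]
    intro s
    refine (intervalIntegral.norm_integral_le_of_norm_le_const
      fun t _ => γ.norm_coe_le_norm _).trans ?_
    rw [mul_comm, sub_zero]
    exact mul_le_mul_of_nonneg_right (abs_le.2 s.2) (norm_nonneg _)

/-- The map sending `((t, x), γ)` to the curve `s ↦ γ s - x - t • ∫₀ˢ f (γ τ) dτ`. Its zeros are the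
integral curves of `t • f` starting at `x`. -/
def flowDefect (hr : 0 ≤ r) (f : C(E, E)) (p : (ℝ × E) × C(Set.Icc (-r) r, E)) :
    C(Set.Icc (-r) r, E) :=
  p.2 - ContinuousLinearMap.const ℝ _ p.1.2 - p.1.1 • primitiveCLM E hr (f.comp p.2)

theorem contDiff_flowDefect (hr : 0 ≤ r) {f : C(E, E)} (hf : ContDiff ℝ ∞ f) :
    ContDiff ℝ ∞ (flowDefect hr f) :=
  (contDiff_snd.sub ((ContinuousLinearMap.const ℝ _).contDiff.comp
    (contDiff_snd.comp contDiff_fst))).sub ((contDiff_fst.comp contDiff_fst).smul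
      ((primitiveCLM E hr).contDiff.comp ((contDiff_postcomp hf).comp contDiff_snd)))

theorem flowDefect_zero_time (hr : 0 ≤ r) (f : C(E, E)) (x : E) (γ : C(Set.Icc (-r) r, E)) :
    flowDefect hr f ((0, x), γ) = γ - .const _ x := by
  ext s
  simp [flowDefect]

theorem isInvertible_fderiv_flowDefect (hr : 0 ≤ r) {f : C(E, E)} (hf : ContDiff ℝ ∞ f) (x : E)
    (γ : C(Set.Icc (-r) r, E)) :
    (fderiv ℝ (flowDefect hr f) ((0, x), γ) ∘L
      .inr ℝ (ℝ × E) C(Set.Icc (-r) r, E)).IsInvertible := by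
  have hpartial := ((contDiff_flowDefect hr hf).differentiable (by simp)
    ((0, x), γ)).hasFDerivAt.comp γ (hasFDerivAt_prodMk_right (𝕜 := ℝ) ((0 : ℝ), x) γ)
  have hid : HasFDerivAt (flowDefect hr f ∘ fun η => ((0, x), η)) (.id ℝ _) γ := by
    rw [show (flowDefect hr f ∘ fun η => ((0, x), η)) = fun η => η - .const _ x from
      funext (flowDefect_zero_time hr f x)]
    exact (hasFDerivAt_id _).sub_const _
  exact ⟨.refl ℝ _, (hpartial.unique hid).symm⟩

theorem IccExtend_zero_of_flowDefect_eq_zero (hr : 0 ≤ r) {f : C(E, E)} {t : ℝ} {x : E}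
    {γ : C(Set.Icc (-r) r, E)} (h : flowDefect hr f ((t, x), γ) = 0) :
    γ.IccExtend (neg_le_self hr) 0 = x := by
  have h0 : (0 : ℝ) ∈ Set.Icc (-r) r := ⟨neg_nonpos.2 hr, hr⟩
  have heval := congrArg (· ⟨0, h0⟩) h
  simp only [flowDefect, primitiveCLM] at heval
  rw [ContinuousMap.coe_IccExtend, Set.IccExtend_of_mem _ _ h0]
  simpa [sub_eq_zero] using heval

variable [CompleteSpace E]

theorem hasDerivAt_IccExtend_of_flowDefect_eq_zero (hr : 0 ≤ r) {f : C(E, E)} {t : ℝ} {x : E}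
    {γ : C(Set.Icc (-r) r, E)} (h : flowDefect hr f ((t, x), γ) = 0) {s : ℝ}
    (hs : s ∈ Set.Ioo (-r) r) :
    HasDerivAt (γ.IccExtend (neg_le_self hr)) (t • f (γ.IccExtend (neg_le_self hr) s)) s := by
  have hcont : Continuous fun τ => f (γ.IccExtend (neg_le_self hr) τ) :=
    f.continuous.comp (γ.IccExtend _).continuous
  refine (((intervalIntegral.integral_hasDerivAt_right (hcont.intervalIntegrable 0 s)
    (hcont.stronglyMeasurableAtFilter _ _) hcont.continuousAt).const_smul t).const_add
      x).congr_of_eventuallyEq ?_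
  filter_upwards [isOpen_Ioo.mem_nhds hs] with τ hτ
  have hτ' := Set.Ioo_subset_Icc_self hτ
  have heval : γ ⟨τ, hτ'⟩ - x - t • ∫ σ in (0 : ℝ)..τ, f (γ.IccExtend (neg_le_self hr) σ) = 0 :=
    congrArg (· ⟨τ, hτ'⟩) h
  rw [ContinuousMap.coe_IccExtend, Set.IccExtend_of_mem _ _ hτ']
  rwa [sub_sub, sub_eq_zero] at heval

theorem exists_contDiffAt_flowDefect_eq_zero (hr : 0 ≤ r) {f : C(E, E)} (hf : ContDiff ℝ ∞ f)
    (x₀ : E) :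
    ∃ Ψ : ℝ × E → C(Set.Icc (-r) r, E), ContDiffAt ℝ ∞ Ψ (0, x₀) ∧ Ψ (0, x₀) = .const _ x₀ ∧
      ∀ᶠ q in 𝓝 ((0 : ℝ), x₀), flowDefect hr f (q, Ψ q) = 0 := by
  have hdefect := (contDiff_flowDefect hr hf).contDiffAt (x := ((0, x₀), .const _ x₀))
  have hinv := isInvertible_fderiv_flowDefect hr hf x₀ (.const _ x₀)
  refine ⟨_, hdefect.contDiffAt_implicitFunction (by simp) hinv,
    hdefect.implicitFunction_apply_self (by simp) hinv, ?_⟩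
  filter_upwards [hdefect.eventually_apply_implicitFunction (by simp) hinv] with q hq
  rw [hq, flowDefect_zero_time, sub_self]

theorem exists_local_flow {f : E → E} (hf : ContDiff ℝ ∞ f) (hr : 0 ≤ r) (x₀ : E) :
    ∃ ψ : ℝ × E → ℝ → E, (∀ s, ContDiffAt ℝ ∞ (fun q => ψ q s) (0, x₀)) ∧
      ∀ U ∈ 𝓝 x₀, ∀ᶠ q in 𝓝 ((0 : ℝ), x₀), ψ q 0 = q.2 ∧
        ∀ s ∈ Set.Ioo (-r) r, ψ q s ∈ U ∧ HasDerivAt (ψ q) (q.1 • f (ψ q s)) s := by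
  obtain ⟨Ψ, hΨ, hΨ0, hdefect⟩ :=
    exists_contDiffAt_flowDefect_eq_zero hr (f := ⟨f, hf.continuous⟩) hf x₀
  let eval (s : ℝ) : C(Set.Icc (-r) r, E) →L[ℝ] E :=
    ContinuousMap.evalCLM ℝ (Set.projIcc (-r) r (neg_le_self hr) s)
  refine ⟨fun q => (Ψ q).IccExtend (neg_le_self hr),
    fun s => (eval s).contDiff.contDiffAt.comp (0, x₀) hΨ, fun U hU => ?_⟩
  obtain ⟨ε, hε, hεU⟩ := Metric.mem_nhds_iff.1 hU
  filter_upwards [hdefect, hΨ.continuousAt.eventually_mem (Metric.ball_mem_nhds _ hε)]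
    with q hq hclose
  refine ⟨IccExtend_zero_of_flowDefect_eq_zero hr hq, fun s hs =>
    ⟨hεU ?_, hasDerivAt_IccExtend_of_flowDefect_eq_zero hr hq hs⟩⟩
  rw [hΨ0] at hclose
  exact (ContinuousMap.dist_apply_le_dist (Set.projIcc (-r) r (neg_le_self hr) s)).trans_lt
    (Metric.mem_ball.1 hclose)

end LocalFlow

theorem exists_contDiff_eventuallyEq {E F : Type*} [NormedAddCommGroup E] [NormedSpace ℝ E]
    [HasContDiffBump E] [NormedAddCommGroup F] [NormedSpace ℝ F] {U : Set E} (hU : IsOpen U)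
    {g : E → F} (hg : ∀ y ∈ U, ContDiffAt ℝ ∞ g y) {y₀ : E} (hy₀ : y₀ ∈ U) :
    ∃ f : E → F, ContDiff ℝ ∞ f ∧ f =ᶠ[𝓝 y₀] g := by
  obtain ⟨ε, hε, hεU⟩ := Metric.nhds_basis_closedBall.mem_iff.1 (hU.mem_nhds hy₀)
  let b : ContDiffBump y₀ := ⟨ε / 2, ε, half_pos hε, half_lt_self hε⟩
  refine ⟨U.indicator fun y => b y • g y, contDiff_indicator_of_forall_eq_zero hU
    Metric.isClosed_closedBall hεU (fun y hy => b.contDiffAt.smul (hg y hy)) fun y _ hy => ?_, ?_⟩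
  · rw [b.zero_of_le_dist (not_le.1 hy).le, zero_smul]
  · filter_upwards [hU.mem_nhds hy₀, b.eventuallyEq_one] with y hy hby
    rw [Set.indicator_of_mem hy, hby, Pi.one_apply, one_smul]

section Flow

variable {E : Type*} [NormedAddCommGroup E] [NormedSpace ℝ E]
  {H : Type*} [TopologicalSpace H] {I : ModelWithCorners ℝ E H}
  {M : Type*} [TopologicalSpace M] [ChartedSpace H M]
  {Y : ∀ p : M, TangentSpace I p} {Φ : ℝ → M → M}

variable (I) in
/-- `Φ` is the global flow of the vector field `Y`. Smoothness of `Φ` is not part of the definition;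
it follows from that of `Y`. -/
structure IsFlow (Y : ∀ p : M, TangentSpace I p) (Φ : ℝ → M → M) : Prop where
  zero (x : M) : Φ 0 x = x
  curve (x : M) : IsMIntegralCurve (I := I) (fun t => Φ t x) Y

theorem IsFlow.eventually_mem_extChartAt_source (h : IsFlow I Y Φ) (x : M) :
    ∀ᶠ s in 𝓝 (0 : ℝ), Φ s x ∈ (extChartAt I x).source := by
  refine (h.curve x).continuous.continuousAt.eventually_mem ?_
  rw [h.zero]
  exact extChartAt_source_mem_nhds x

variable [IsManifold I ∞ M]

theorem IsFlow.hasDerivAt_extChartAt (h : IsFlow I Y Φ) {c x : M} {s : ℝ}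
    (hs : Φ s x ∈ (extChartAt I c).source) :
    HasDerivAt (fun s => extChartAt I c (Φ s x)) (coordComp I c (Φ s x) (Y (Φ s x))) s := by
  have hcomp := HasMFDerivAt.comp s
    (mdifferentiableAt_extChartAt (I := I) (x := c) (y := Φ s x) (by simpa using hs)).hasMFDerivAt
    (h.curve x s)
  rw [← coordComp_eq_mfderiv hs] at hcomp
  have hfderiv : HasFDerivAt (fun s => extChartAt I c (Φ s x)) ((coordComp I c (Φ s x)).comp
      ((1 : ℝ →L[ℝ] ℝ).smulRight (Y (Φ s x))) : ℝ →L[ℝ] E) s :=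
    hasMFDerivAt_iff_hasFDerivAt.1 hcomp
  rw [← one_smul ℝ (Y (Φ s x))]
  exact hfderiv.hasDerivAt

variable [I.Boundaryless]

theorem hasMFDerivAt_extChartAt_symm_comp {c : M} {z : ℝ → E} {s : ℝ}
    (hs : z s ∈ (extChartAt I c).target) {v : TangentSpace I ((extChartAt I c).symm (z s))}
    (hz : HasDerivAt z (coordComp I c _ v) s) :
    HasMFDerivAt 𝓘(ℝ, ℝ) I (fun s => (extChartAt I c).symm (z s)) s
      ((1 : ℝ →L[ℝ] ℝ).smulRight v) := by
  refine (((contMDiffAt_extChartAt_symm hs).mdifferentiableAt (by simp)).hasMFDerivAt.comp s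
    hz.hasFDerivAt.hasMFDerivAt).congr_mfderiv ?_
  have hv := coordField_symm hs (coordComp I c _ v)
  rw [coordField_coordComp ((extChartAt I c).map_target hs)] at hv
  ext
  exact (congrArg (mfderiv 𝓘(ℝ, E) I (extChartAt I c).symm (z s)) (one_smul ℝ _)).trans
    (hv.symm.trans (one_smul ℝ v).symm)

section Local

variable [CompleteSpace E] [HasContDiffBump E]

theorem exists_local_flow_manifold (hY : ContMDiff I I.tangent ∞ (T% Y)) (x₀ : M) :
    ∃ φ : ℝ × M → M, ContMDiffAt (𝓘(ℝ, ℝ).prod I) I ∞ φ (0, x₀) ∧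
      ∀ᶠ q in 𝓝 ((0 : ℝ), x₀), ∃ γ : ℝ → M, γ 0 = q.2 ∧ γ 1 = φ q ∧
        IsMIntegralCurveOn (I := I) γ (q.1 • Y) (Set.Ioo (-2) 2) := by
  let e := extChartAt I x₀
  have hx₀ : x₀ ∈ e.source := mem_extChartAt_source x₀
  have htarget : IsOpen e.target := isOpen_extChartAt_target x₀
  obtain ⟨f, hf, hfY⟩ := exists_contDiff_eventuallyEq htarget
    (fun y hy => contDiffAt_coordRep (k := ⊤) hy (hY _)) (e.map_source hx₀)
  obtain ⟨ψ, hψ, hflow⟩ := exists_local_flow hf zero_le_two (e x₀)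
  have hflow := hflow (e.target ∩ {y | f y = coordRep I x₀ Y y})
    (Filter.inter_mem (htarget.mem_nhds (e.map_source hx₀)) hfY)
  have hmem : ψ (0, e x₀) 1 ∈ e.target := (hflow.self_of_nhds.2 1 (by norm_num)).1.1
  have hchart : ContMDiffAt (𝓘(ℝ, ℝ).prod I) 𝓘(ℝ, ℝ × E) ∞ (fun q : ℝ × M => (q.1, e q.2))
      (0, x₀) :=
    contMDiffAt_fst.prodMk_space (contMDiffAt_extChartAt.comp (0, x₀) contMDiffAt_snd)
  have hsource : ∀ᶠ q : ℝ × M in 𝓝 (0, x₀), q.2 ∈ e.source :=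
    continuousAt_snd.eventually_mem (extChartAt_source_mem_nhds x₀)
  refine ⟨fun q => e.symm (ψ (q.1, e q.2) 1), (contMDiffAt_extChartAt_symm hmem).comp (0, x₀)
    ((hψ 1).contMDiffAt.comp (0, x₀) hchart), ?_⟩
  filter_upwards [hchart.continuousAt.eventually hflow, hsource] with q ⟨hq0, hq⟩ hq2
  refine ⟨fun s => e.symm (ψ (q.1, e q.2) s), (congrArg e.symm hq0).trans (e.left_inv hq2), rfl,
    fun s hs => ?_⟩
  obtain ⟨⟨hy, hfy⟩, hderiv⟩ := hq s hs
  refine (hasMFDerivAt_extChartAt_symm_comp hy (hderiv.congr_deriv ?_)).hasMFDerivWithinAt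
  exact (congrArg (q.1 • ·) (Set.mem_ofPred_eq.mp hfy)).trans (map_smul _ q.1 _).symm

theorem exists_isFlow [CompactSpace M] [T2Space M] (hY : ContMDiff I I.tangent ∞ (T% Y)) :
    ∃ Φ, IsFlow I Y Φ := by
  have hlocal : ∀ᶠ ε in 𝓝 (0 : ℝ), ∀ x ∈ (Set.univ : Set M), ∃ γ : ℝ → M, γ 0 = x ∧
      IsMIntegralCurveOn (I := I) γ (ε • Y) (Set.Ioo (-2) 2) := by
    refine isCompact_univ.eventually_forall_of_forall_eventually fun x _ => ?_
    obtain ⟨φ, -, hφ⟩ := exists_local_flow_manifold hY x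
    filter_upwards [hφ] with q ⟨γ, hγ0, _, hγ⟩ using ⟨γ, hγ0, hγ⟩
  obtain ⟨ε, hcurve, hε : 0 < ε⟩ := ((hlocal.filter_mono nhdsWithin_le_nhds).and
    (self_mem_nhdsWithin (a := (0 : ℝ)) (s := Set.Ioi 0))).exists
  have huniform (x : M) : ∃ γ : ℝ → M, γ 0 = x ∧
      IsMIntegralCurveOn (I := I) γ Y (Set.Ioo (-ε) ε) := by
    obtain ⟨γ, hγ0, hγ⟩ := hcurve x (Set.mem_univ x)
    refine ⟨γ ∘ (· * ε⁻¹), by simpa using hγ0, ?_⟩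
    have hscaled := hγ.comp_mul ε⁻¹
    rw [smul_smul, inv_mul_cancel₀ hε.ne', one_smul] at hscaled
    refine hscaled.mono fun t ht => ?_
    have ht1 : |t * ε⁻¹| < 1 := by
      rw [abs_mul, abs_of_pos (inv_pos.2 hε), ← div_eq_mul_inv, div_lt_one hε]
      exact abs_lt.2 ht
    exact ⟨by linarith [(abs_lt.1 ht1).1], by linarith [(abs_lt.1 ht1).2]⟩
  choose Φ hΦ using exists_isMIntegralCurve_of_isMIntegralCurveOn
    (hY.of_le (by exact_mod_cast le_top)) hε huniform
  exact ⟨fun t x => Φ x t, fun x => (hΦ x).1, fun x => (hΦ x).2⟩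

end Local

namespace IsFlow

variable [T2Space M]

theorem add (h : IsFlow I Y Φ) (hY : ContMDiff I I.tangent 1 (T% Y)) (s t : ℝ) (x : M) :
    Φ (s + t) x = Φ s (Φ t x) := by
  refine congrFun (isMIntegralCurve_Ioo_eq_of_contMDiff_boundaryless (t₀ := 0) hY
    ((h.curve x).comp_add t) (h.curve (Φ t x)) ?_) s
  simp [h.zero]

variable [CompleteSpace E] [HasContDiffBump E]

theorem contMDiffAt_zero (h : IsFlow I Y Φ) (hY : ContMDiff I I.tangent ∞ (T% Y)) (x : M) :
    ContMDiffAt (𝓘(ℝ, ℝ).prod I) I ∞ (fun q : ℝ × M => Φ q.1 q.2) (0, x) := by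
  obtain ⟨φ, hφ, hcurves⟩ := exists_local_flow_manifold hY x
  refine hφ.congr_of_eventuallyEq ?_
  filter_upwards [hcurves] with q ⟨γ, hγ0, hγ1, hγ⟩
  have hY1 : ContMDiff I I.tangent 1 (T% (q.1 • Y)) :=
    (contMDiff_const.smul_section hY).of_le (by exact_mod_cast le_top)
  have hEq := isMIntegralCurveOn_Ioo_eqOn_of_contMDiff_boundaryless (t₀ := 0) (by norm_num) hY1
    (((h.curve q.2).comp_mul q.1).isMIntegralCurveOn (Set.Ioo (-2) 2)) hγ (by simp [hγ0, h.zero])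
    (show (1 : ℝ) ∈ Set.Ioo (-2) 2 by norm_num)
  simpa [hγ1] using hEq

theorem eventually_contMDiffAt (h : IsFlow I Y Φ) (hY : ContMDiff I I.tangent ∞ (T% Y)) (k : ℕ)
    (x : M) : ∀ᶠ q in 𝓝 ((0 : ℝ), x), ContMDiffAt I I k (Φ q.1) q.2 := by
  have hk : (k : WithTop ℕ∞) ≤ ∞ := by exact_mod_cast le_top
  have : IsManifold I k M := .of_le hk
  filter_upwards [(contMDiffAt_iff_contMDiffAt_nhds (by simp)).1
    ((h.contMDiffAt_zero hY x).of_le hk)] with q hq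
  exact ContMDiffAt.comp (g := fun q : ℝ × M => Φ q.1 q.2) q.2 (f := fun x => (q.1, x)) hq
    (contMDiffAt_const.prodMk contMDiffAt_id)

variable [CompactSpace M]

theorem eventually_contMDiff (h : IsFlow I Y Φ) (hY : ContMDiff I I.tangent ∞ (T% Y)) (k : ℕ) :
    ∀ᶠ t in 𝓝 (0 : ℝ), ContMDiff I I k (Φ t) := by
  have hforall : ∀ᶠ t in 𝓝 (0 : ℝ), ∀ x ∈ (Set.univ : Set M), ContMDiffAt I I k (Φ t) x :=
    isCompact_univ.eventually_forall_of_forall_eventually fun x _ => h.eventually_contMDiffAt hY k x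
  filter_upwards [hforall] with t ht x using ht x (Set.mem_univ x)

theorem contMDiff (h : IsFlow I Y Φ) (hY : ContMDiff I I.tangent ∞ (T% Y)) (t : ℝ) :
    ContMDiff I I ∞ (Φ t) := by
  refine contMDiff_infty.2 fun k => ?_
  obtain ⟨N, hN, hN0⟩ := (((tendsto_const_div_atTop_nhds_zero_nat t).eventually
    (h.eventually_contMDiff hY k)).and (Filter.eventually_gt_atTop 0)).exists
  have hiterate (m : ℕ) : ContMDiff I I k (Φ (m * (t / N))) := by
    induction m with
    | zero =>
      rw [Nat.cast_zero, zero_mul, show Φ 0 = id from funext h.zero]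
      exact contMDiff_id
    | succ m ih =>
      rw [show Φ ((m + 1 : ℕ) * (t / N)) = Φ (t / N) ∘ Φ (m * (t / N)) from funext fun x => by
        rw [Function.comp_apply, ← h.add (hY.of_le (by exact_mod_cast le_top)), Nat.cast_succ,
          add_one_mul, add_comm]]
      exact hN.comp ih
  have hN0' : (N : ℝ) ≠ 0 := Nat.cast_ne_zero.2 hN0.ne'
  simpa [mul_div_cancel₀ _ hN0'] using hiterate N

/-- The diffeomorphisms of a flow on a compact manifold. -/
def diffeomorph (h : IsFlow I Y Φ) (hY : ContMDiff I I.tangent ∞ (T% Y)) (t : ℝ) :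
    Diffeomorph I I M M ∞ where
  toFun := Φ t
  invFun := Φ (-t)
  left_inv x := by
    rw [← h.add (hY.of_le (by exact_mod_cast le_top)), neg_add_cancel, h.zero]
  right_inv x := by
    rw [← h.add (hY.of_le (by exact_mod_cast le_top)), add_neg_cancel, h.zero]
  contMDiff_toFun := h.contMDiff hY t
  contMDiff_invFun := h.contMDiff hY (-t)

end IsFlow

end Flow

theorem hasDerivAt_fderiv_of_hasDerivAt {E F : Type*} [NormedAddCommGroup E] [NormedSpace ℝ E]
    [NormedAddCommGroup F] [NormedSpace ℝ F] {φ : ℝ × E → F} {f : E → F} {t₀ : ℝ} {y₀ : E}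
    (hφ : ContDiffAt ℝ 2 φ (t₀, y₀)) (hf : ∀ᶠ y in 𝓝 y₀, HasDerivAt (fun s => φ (s, y)) (f y) t₀)
    (u : E) : HasDerivAt (fun s => fderiv ℝ φ (s, y₀) (0, u)) (fderiv ℝ f y₀ u) t₀ := by
  have hφ' : HasFDerivAt (fderiv ℝ φ) (fderiv ℝ (fderiv ℝ φ) (t₀, y₀)) (t₀, y₀) :=
    ((hφ.fderiv_right (m := 1) (by norm_num)).differentiableAt (by simp)).hasFDerivAt
  have htime : HasDerivAt (fun s => fderiv ℝ φ (s, y₀) (0, u))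
      (fderiv ℝ (fderiv ℝ φ) (t₀, y₀) (1, 0) (0, u)) t₀ := by
    have hcurve : HasDerivAt (fun s : ℝ => (s, y₀)) ((1 : ℝ), (0 : E)) t₀ :=
      (hasDerivAt_id _).prodMk (hasDerivAt_const _ _)
    have hcomp : HasDerivAt (fun s => fderiv ℝ φ (s, y₀))
        (fderiv ℝ (fderiv ℝ φ) (t₀, y₀) (1, 0)) t₀ :=
      hφ'.comp_hasDerivAt t₀ hcurve
    simpa using hcomp.clm_apply (hasDerivAt_const t₀ ((0 : ℝ), u))
  have hspace : HasFDerivAt (fun y => fderiv ℝ φ (t₀, y) (1, 0))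
      (((fderiv ℝ (fderiv ℝ φ) (t₀, y₀)).comp (.inr ℝ ℝ E)).flip (1, 0)) y₀ := by
    simpa using (hφ'.comp y₀ (hasFDerivAt_prodMk_right t₀ y₀)).clm_apply
      (hasFDerivAt_const ((1 : ℝ), (0 : E)) y₀)
  have hpartial : f =ᶠ[𝓝 y₀] fun y => fderiv ℝ φ (t₀, y) (1, 0) := by
    have hdiff : ∀ᶠ y in 𝓝 y₀, DifferentiableAt ℝ φ (t₀, y) :=
      ((Continuous.prodMk_right t₀).tendsto y₀).eventually
        ((hφ.eventually (by simp)).mono fun q hq => hq.differentiableAt (by simp))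
    filter_upwards [hdiff, hf] with y hy hfy
    exact hfy.unique (hy.hasFDerivAt.comp_hasDerivAt t₀
      ((hasDerivAt_id t₀).prodMk (hasDerivAt_const t₀ y)))
  have hsymm : IsSymmSndFDerivAt ℝ φ (t₀, y₀) := hφ.isSymmSndFDerivAt (by simp)
  rw [(hspace.congr_of_eventuallyEq hpartial).fderiv]
  exact htime.congr_deriv (hsymm.eq _ _)

theorem hasDerivAt_bilinear_apply_self {E F G : Type*} [NormedAddCommGroup E] [NormedSpace ℝ E]
    [NormedAddCommGroup F] [NormedSpace ℝ F] [NormedAddCommGroup G] [NormedSpace ℝ G]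
    {B : E → F →L[ℝ] F →L[ℝ] G} {z : ℝ → E} {a : ℝ → F} {z' : E} {a' : F} {t : ℝ}
    (hB : DifferentiableAt ℝ B (z t)) (hz : HasDerivAt z z' t) (ha : HasDerivAt a a' t) :
    HasDerivAt (fun s => B (z s) (a s) (a s))
      (fderiv ℝ B (z t) z' (a t) (a t) + B (z t) a' (a t) + B (z t) (a t) a') t := by
  have hcomp := HasFDerivAt.comp_hasDerivAt (f := z) (l := B) t hB.hasFDerivAt hz
  refine ((hcomp.clm_apply ha).clm_apply ha).congr_deriv ?_
  rw [_root_.add_apply, Function.comp_apply]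

section Killing

variable {E : Type*} [NormedAddCommGroup E] [NormedSpace ℝ E]
  {H : Type*} [TopologicalSpace H] {I : ModelWithCorners ℝ E H}
  {M : Type*} [TopologicalSpace M] [ChartedSpace H M] [IsManifold I ∞ M]
  {Y : ∀ p : M, TangentSpace I p} {Φ : ℝ → M → M} {c p : M}

section CoordMetric

variable [RiemannianBundle (fun x : M => TangentSpace I x)]

variable (I) in
/-- The metric in the chart around `c`, as a function of the coordinates with values in the
bilinear forms on the model space. -/
def coordMetric (c : M) (y : E) : E →L[ℝ] E →L[ℝ] ℝ :=
  (metricTensor I ((extChartAt I c).symm y)).bilinearComp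
    ((trivializationAt E (TangentSpace I : M → Type _) c).symmL ℝ _)
    ((trivializationAt E (TangentSpace I : M → Type _) c).symmL ℝ _)

theorem coordMetric_apply (y u w : E) :
    coordMetric I c y u w = inner ℝ (coordField I c u ((extChartAt I c).symm y))
      (coordField I c w ((extChartAt I c).symm y)) :=
  rfl

theorem coordMetric_extChartAt_apply (hp : p ∈ (extChartAt I c).source) (u w : E) :
    coordMetric I c (extChartAt I c p) u w = inner ℝ (coordField I c u p) (coordField I c w p) := by
  rw [coordMetric_apply, (extChartAt I c).left_inv hp]

theorem coordMetric_extChartAt_coordComp (hp : p ∈ (extChartAt I c).source)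
    (v w : TangentSpace I p) :
    coordMetric I c (extChartAt I c p) (coordComp I c p v) (coordComp I c p w) = inner ℝ v w := by
  rw [coordMetric_extChartAt_apply hp, coordField_coordComp hp, coordField_coordComp hp]

variable [I.Boundaryless]
  [IsContMDiffRiemannianBundle I ∞ E (fun x : M => TangentSpace I x)]
  [FiniteDimensional ℝ E]

theorem contDiffOn_coordMetric (c : M) :
    ContDiffOn ℝ ∞ (coordMetric I c) (extChartAt I c).target := by
  refine contDiffOn_clm_apply.2 fun u => contDiffOn_clm_apply.2 fun w y hy => ?_
  have hp := (extChartAt I c).map_target hy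
  have hinner := ContMDiffAt.inner_bundle (IB := I) (F := E)
    (E := fun x : M => TangentSpace I x) (contMDiffAt_coordField hp u)
    (contMDiffAt_coordField hp w)
  exact (contMDiffAt_iff_contDiffAt.1
    (hinner.comp y (contMDiffAt_extChartAt_symm hy))).contDiffWithinAt

theorem differentiableAt_coordMetric (hp : p ∈ (extChartAt I c).source) :
    DifferentiableAt ℝ (coordMetric I c) (extChartAt I c p) :=
  ((contDiffOn_coordMetric c).contDiffAt ((isOpen_extChartAt_target c).mem_nhds
    ((extChartAt I c).map_source hp))).differentiableAt (by simp)

theorem fderiv_coordMetric_apply (hp : p ∈ (extChartAt I c).source) (u w z : E) :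
    fderiv ℝ (coordMetric I c) (extChartAt I c p) z u w =
      mvfderiv I (fun q => (inner ℝ (coordField I c u q) (coordField I c w q) : ℝ)) p
        (coordField I c z p) := by
  rw [mvfderiv_coordField hp (mdiffAt_inner (mdifferentiableAt_coordField hp u)
    (mdifferentiableAt_coordField hp w))]
  have happly := ((differentiableAt_coordMetric hp).hasFDerivAt.clm_apply
    (hasFDerivAt_const u _)).clm_apply (hasFDerivAt_const w _)
  refine Eq.trans ?_ (congrArg (fun A => A z) happly.fderiv).symm
  simp

theorem hasDerivAt_coordMetric_apply_self (hp : p ∈ (extChartAt I c).source) {a z : ℝ → E}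
    {a' z' : E} {t : ℝ} (ha : HasDerivAt a a' t) (hz : HasDerivAt z z' t)
    (hzt : z t = extChartAt I c p) :
    HasDerivAt (fun s => coordMetric I c (z s) (a s) (a s))
      (2 * inner ℝ (coordField I c a' p) (coordField I c (a t) p) +
        mvfderiv I (fun q => (inner ℝ (coordField I c (a t) q) (coordField I c (a t) q) : ℝ)) p
          (coordField I c z' p)) t := by
  have hdiff : DifferentiableAt ℝ (coordMetric I c) (z t) :=
    hzt ▸ differentiableAt_coordMetric hp
  refine (hasDerivAt_bilinear_apply_self hdiff hz ha).congr_deriv ?_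
  rw [hzt, fderiv_coordMetric_apply hp, coordMetric_extChartAt_apply hp,
    coordMetric_extChartAt_apply hp, real_inner_comm]
  ring

end CoordMetric

namespace IsFlow

variable [I.Boundaryless] [T2Space M]

section Linearization

variable [CompleteSpace E] [HasContDiffBump E]

theorem contDiffAt_coord (h : IsFlow I Y Φ) (hY : ContMDiff I I.tangent ∞ (T% Y)) (x : M) :
    ContDiffAt ℝ ∞ (fun q : ℝ × E => extChartAt I x (Φ q.1 ((extChartAt I x).symm q.2)))
      (0, extChartAt I x x) := by
  rw [← contMDiffAt_iff_contDiffAt]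
  have hx := (extChartAt I x).map_source (mem_extChartAt_source (I := I) x)
  have hsymm : ContMDiffAt 𝓘(ℝ, ℝ × E) (𝓘(ℝ, ℝ).prod I) ∞
      (fun q : ℝ × E => (q.1, (extChartAt I x).symm q.2)) (0, extChartAt I x x) :=
    contDiff_fst.contMDiff.contMDiffAt.prodMk ((contMDiffAt_extChartAt_symm hx).comp
      ((0 : ℝ), extChartAt I x x) contDiff_snd.contMDiff.contMDiffAt)
  refine contMDiffAt_extChartAt.comp_of_eq
    ((h.contMDiffAt_zero hY x).comp_of_eq hsymm (by simp)) ?_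
  simp [h.zero]

theorem hasDerivAt_coordComp_mfderiv (h : IsFlow I Y Φ)
    (hY : ContMDiff I I.tangent ∞ (T% Y)) (x : M) (v : TangentSpace I x) :
    HasDerivAt (fun s => coordComp I x (Φ s x) (mfderiv I I (Φ s) x v))
      (fderiv ℝ (coordRep I x Y) (extChartAt I x x) (coordComp I x x v)) 0 := by
  let e := extChartAt I x
  have hx : x ∈ e.source := mem_extChartAt_source x
  let φ : ℝ × E → E := fun q => e (Φ q.1 (e.symm q.2))
  have hφ : ContDiffAt ℝ 2 φ (0, e x) := (h.contDiffAt_coord hY x).of_le ENat.LEInfty.out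
  have hcurves : ∀ᶠ y in 𝓝 (e x), HasDerivAt (fun s => φ (s, y)) (coordRep I x Y y) 0 := by
    filter_upwards [(isOpen_extChartAt_target x).mem_nhds (e.map_source hx)] with y hy
    have hderiv := h.hasDerivAt_extChartAt (c := x) (x := e.symm y) (s := 0)
      (by rw [h.zero]; exact e.map_target hy)
    rwa [h.zero] at hderiv
  refine (hasDerivAt_fderiv_of_hasDerivAt hφ hcurves (coordComp I x x v)).congr_of_eventuallyEq ?_
  have htime : Filter.Tendsto (fun s : ℝ => (s, e x)) (𝓝 0) (𝓝 (0, e x)) :=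
    (Continuous.prodMk_left (e x)).tendsto 0
  have htime' : Filter.Tendsto (fun s : ℝ => (s, x)) (𝓝 0) (𝓝 (0, x)) :=
    (Continuous.prodMk_left x).tendsto 0
  filter_upwards [h.eventually_mem_extChartAt_source x,
    htime.eventually (hφ.eventually (by simp)),
    htime'.eventually (h.eventually_contMDiffAt hY 1 x)] with s hs hφs hΦs
  have hΦ : MDifferentiableAt I I (Φ s) x := hΦs.mdifferentiableAt (by simp)
  have he := mdifferentiableAt_extChartAt (I := I) (x := x) (y := Φ s x) (by simpa using hs)
  calc coordComp I x (Φ s x) (mfderiv I I (Φ s) x v)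
      = mvfderiv I (e ∘ Φ s) x v := by
        rw [coordComp_eq_mfderiv hs]
        exact congrArg (fun A => A v) (mfderiv_comp x he hΦ).symm
    _ = fderiv ℝ ((e ∘ Φ s) ∘ e.symm) (e x) (coordComp I x x v) :=
        mvfderiv_eq_fderiv_coordComp hx (he.comp x hΦ) v
    _ = fderiv ℝ φ (s, e x) (0, coordComp I x x v) :=
        congrArg (fun A => A (coordComp I x x v)) ((hφs.differentiableAt (by simp)).hasFDerivAt.comp
          (e x) (hasFDerivAt_prodMk_right s (e x))).fderiv

end Linearization

variable [RiemannianBundle (fun x : M => TangentSpace I x)]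
  [IsContMDiffRiemannianBundle I ∞ E (fun x : M => TangentSpace I x)]
  [FiniteDimensional ℝ E]

theorem hasDerivAt_metricTensor_mfderiv_zero (h : IsFlow I Y Φ)
    (hY : ContMDiff I I.tangent ∞ (T% Y)) (x : M) (v : TangentSpace I x) :
    HasDerivAt (fun s => metricTensor I (Φ s x) (mfderiv I I (Φ s) x v) (mfderiv I I (Φ s) x v))
      (2 * inner ℝ (nabla I Y x v) v) 0 := by
  have : CompleteSpace E := FiniteDimensional.complete ℝ E
  have hx : x ∈ (extChartAt I x).source := mem_extChartAt_source x
  have hYx : MDiffAt (T% Y) x := (hY x).mdifferentiableAt (by simp)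
  let V := coordField I x (coordComp I x x v)
  have hV : MDiffAt (T% V) x := mdifferentiableAt_coordField hx _
  have hVx : V x = v := coordField_coordComp hx v
  have hcoord : HasDerivAt (fun s => extChartAt I x (Φ s x)) (coordComp I x x (Y x)) 0 := by
    have hderiv := h.hasDerivAt_extChartAt (c := x) (x := x) (s := 0) (by rwa [h.zero])
    rwa [h.zero] at hderiv
  have hinit : coordComp I x (Φ 0 x) (mfderiv I I (Φ 0) x v) = coordComp I x x v := by
    rw [show Φ 0 = id from funext h.zero, mfderiv_id]
    rfl
  have hderiv := hasDerivAt_coordMetric_apply_self hx (h.hasDerivAt_coordComp_mfderiv hY x v)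
    hcoord (by rw [h.zero])
  refine (hderiv.congr_of_eventuallyEq ?_).congr_deriv ?_
  · filter_upwards [h.eventually_mem_extChartAt_source x] with s hs
    exact (coordMetric_extChartAt_coordComp hs _ _).symm
  · rw [hinit, coordField_coordComp hx (Y x), ← mlieBracket_coordField hx hYx]
    change 2 * inner ℝ (mlieBracket I V Y x) (V x) +
      mvfderiv I (fun q => (inner ℝ (V q) (V q) : ℝ)) x (Y x) = _
    rw [mvfderiv_inner hV hV, mlieBracket_eq_nabla_sub_nabla hV hYx, hVx, inner_sub_left,
      real_inner_comm (nabla I V x (Y x)) v]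
    ring

variable [CompactSpace M]

theorem hasDerivAt_metricTensor_mfderiv (h : IsFlow I Y Φ)
    (hY : ContMDiff I I.tangent ∞ (T% Y)) (x : M) (v : TangentSpace I x) (t : ℝ) :
    HasDerivAt (fun s => metricTensor I (Φ s x) (mfderiv I I (Φ s) x v) (mfderiv I I (Φ s) x v))
      (2 * inner ℝ (nabla I Y (Φ t x) (mfderiv I I (Φ t) x v)) (mfderiv I I (Φ t) x v)) t := by
  have : CompleteSpace E := FiniteDimensional.complete ℝ E
  have hzero := h.hasDerivAt_metricTensor_mfderiv_zero hY (Φ t x) (mfderiv I I (Φ t) x v)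
  rw [← sub_self t] at hzero
  refine (hzero.comp_sub_const t t).congr_of_eventuallyEq (.of_forall fun s => ?_)
  have hcomp : Φ s = Φ (s - t) ∘ Φ t := funext fun y => by
    rw [Function.comp_apply, ← h.add (hY.of_le (by exact_mod_cast le_top)), sub_add_cancel]
  have hdiff (r : ℝ) (y : M) : MDifferentiableAt I I (Φ r) y :=
    (h.contMDiff hY r y).mdifferentiableAt (by simp)
  beta_reduce
  rw [hcomp, mfderiv_comp x (hdiff (s - t) (Φ t x)) (hdiff t x)]
  rfl

theorem metricTensor_mfderiv_self (h : IsFlow I Y Φ) (hY : ContMDiff I I.tangent ∞ (T% Y))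
    (hnabla : ∀ (x : M) (v : TangentSpace I x), inner ℝ (nabla I Y x v) v = 0) (t : ℝ) (x : M)
    (v : TangentSpace I x) :
    metricTensor I (Φ t x) (mfderiv I I (Φ t) x v) (mfderiv I I (Φ t) x v) =
      metricTensor I x v v := by
  have hderiv (s : ℝ) := h.hasDerivAt_metricTensor_mfderiv hY x v s
  simp only [hnabla, mul_zero] at hderiv
  refine (is_const_of_deriv_eq_zero (fun s => (hderiv s).differentiableAt)
    (fun s => (hderiv s).deriv) t 0).trans ?_
  rw [show Φ 0 = id from funext h.zero, mfderiv_id]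
  rfl

theorem isRiemannianIsometry (h : IsFlow I Y Φ) (hY : ContMDiff I I.tangent ∞ (T% Y))
    (hnabla : ∀ (x : M) (v : TangentSpace I x), inner ℝ (nabla I Y x v) v = 0) (t : ℝ) :
    IsRiemannianIsometry I (Φ t) := by
  have : CompleteSpace E := FiniteDimensional.complete ℝ E
  refine ⟨⟨h.diffeomorph hY t, rfl⟩, fun x v w => ?_⟩
  have hnorm := h.metricTensor_mfderiv_self hY hnabla t x
  have hadd := hnorm (v + w)
  have hv := hnorm v
  have hw := hnorm w
  rw [map_add] at hadd
  simp only [metricTensor_apply] at hadd hv hw ⊢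
  rw [real_inner_add_add_self, real_inner_add_add_self] at hadd
  linarith

end IsFlow

variable [I.Boundaryless] [T2Space M] [CompactSpace M]
  [RiemannianBundle (fun x : M => TangentSpace I x)]
  [IsContMDiffRiemannianBundle I ∞ E (fun x : M => TangentSpace I x)]
  [FiniteDimensional ℝ E]

theorem isKilling_iff (hY : ContMDiff I I.tangent ∞ (T% Y)) :
    IsKilling I Y ↔ ∀ x : M, nablaFormSym I (flat I Y) x = 0 := by
  have : CompleteSpace E := FiniteDimensional.complete ℝ E
  simp only [fun x => nablaFormSym_flat_eq_zero_iff ((hY x).mdifferentiableAt (by simp))]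
  refine ⟨fun ⟨Φ, hzero, hcurve, hisometry⟩ x v => ?_, fun hnabla => ?_⟩
  · have h : IsFlow I Y Φ := ⟨hzero, hcurve⟩
    have hderiv := h.hasDerivAt_metricTensor_mfderiv_zero hY x v
    simp only [fun s => (hisometry s).2 x v v] at hderiv
    linarith [hderiv.unique (hasDerivAt_const (0 : ℝ) _)]
  · obtain ⟨Φ, h⟩ := exists_isFlow hY
    exact ⟨Φ, h.zero, h.curve, h.isRiemannianIsometry hY hnabla⟩

end Killing

end RiemGeom

end

theorem mainTheorem10 (n : ℕ) {M : Type*} [TopologicalSpace M]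
    [ChartedSpace (EuclideanSpace ℝ (Fin n)) M] [IsManifold (𝓡 n) ∞ M]
    [CompactSpace M] [T2Space M]
    [RiemannianBundle (fun x : M => TangentSpace (𝓡 n) x)]
    [IsContMDiffRiemannianBundle (𝓡 n) ∞ (EuclideanSpace ℝ (Fin n))
      (fun x : M => TangentSpace (𝓡 n) x)]
    (o : RiemGeom.ManifoldOrientation n M) :
    (∀ (𝔤 : LieSubalgebra ℝ (RiemGeom.VField n M)) (adT : 𝔤 → 𝔤 →ₗ[ℝ] 𝔤),
      (∀ X : 𝔤, RiemGeom.IsAdjointOfAd o 𝔤 X (adT X)) →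
      ∀ X Y : 𝔤,
        2 * RiemGeom.integralVol o
            (fun x => RiemGeom.metricTensor (𝓡 n) x ((adT X X).1 x) (Y.1 x)) =
          RiemGeom.integralVol o
            (fun x => RiemGeom.symDivTensor o Y.1 x (X.1 x) (X.1 x))) ∧
    (∀ (Y : RiemGeom.VField n M) (x : M),
      RiemGeom.metricTrace (RiemGeom.symDivTensor o Y x) = (n + 2) * RiemGeom.divergence o Y x) ∧
    (∀ Y : RiemGeom.VField n M,
      ((∀ x : M, RiemGeom.symDivTensor o Y x = 0) ↔
        ∀ x : M, RiemGeom.nablaFormSym (𝓡 n) (RiemGeom.flat (𝓡 n) Y) x = 0) ∧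
      ((∀ x : M, RiemGeom.symDivTensor o Y x = 0) ↔ RiemGeom.IsKilling (𝓡 n) Y)) := by
  refine ⟨fun 𝔤 adT hadT X Y => ?_,
    fun Y x => RiemGeom.metricTrace_symDivTensor o Y.mdifferentiableAt, fun Y => ?_⟩
  · have hadjoint : RiemGeom.l2Inner o (adT X X).1 Y.1 = RiemGeom.l2Inner o X.1 ⁅X, Y⁆.1 :=
      hadT X X Y
    exact (congrArg (2 * ·) hadjoint).trans
      (RiemGeom.integralVol_symDivTensor_apply_self o (X.1.contMDiff.of_le (mod_cast le_top))
        (Y.1.contMDiff.of_le (mod_cast le_top))).symm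
  · have hsym : (∀ x : M, RiemGeom.symDivTensor o Y x = 0) ↔
        ∀ x : M, RiemGeom.nablaFormSym (𝓡 n) (RiemGeom.flat (𝓡 n) Y) x = 0 :=
      forall_congr' fun x => RiemGeom.symDivTensor_eq_zero_iff o Y.mdifferentiableAt
    exact ⟨hsym, hsym.trans (RiemGeom.isKilling_iff Y.contMDiff).symm⟩
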